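/- Let $r$ be a fixed non-negative integer. For a finite nonempty universe $\mathcal U$ with $n$ elements (which may carry further data, such as weights of its elements or a graph on them), let $\mathcal U^r$ be the collection of all subsets of $\mathcal U$ of size at most $r$, and let $\alpha:\mathcal U^r\times\mathcal U^r\to\{0,1\}$ be a function, given on every universe of some class of universes. Two sets $s,t\in\mathcal U^r$ are said to $\alpha$-conflict if $\alpha(s,t)=1$. The function $\alpha$ is called well-conditioned if (i) it is hereditary: if $\alpha(s,t)=0$, then $\alpha(s',t')=0$ for all $s'\subseteq s$ and $t'\subseteq t$; (ii) if $\alpha(s,t)=1$, then $|s\cap t|\ge 1$ and, for all $s'\subseteq s$ and $t'\subseteq t$ with $\alpha(s',t')=0$, we have $(s\cap t)\setminus(s'\cap t')\neq\emptyset$; (iii) it is computable in polynomial time in $n$, that is, in time $O(n^d)$ for some constant $d$. The $r$-Set Packing with $\alpha()$-Overlap problem is: given a universe $\mathcal U$ of the class, a collection $\mathcal S$ of distinct sets from $\mathcal U^r$ and an integer $k\ge 0$ (the parameter), decide whether $\mathcal S$ contains a $(k,\alpha())$-set packing, i.e. at least $k$ distinct sets such that $\alpha(S,S')=0$ for every two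 different sets $S,S'$ among them. Theorem. If $\alpha$ is well-conditioned, then the $r$-Set Packing with $\alpha()$-Overlap problem can be solved in time $$O\bigl(r^{rk}\,k^{(r+1)k}\,n^{cr}\bigr)$$ (with $0^0=1$), where $c$ is a constant that depends only on the exponent $d$ of the running time of $\alpha$, and the constant hidden in the $O$ depends only on $r$ and $\alpha$. In particular, the problem parameterized by $k$ is fixed-parameter tractable: it can be solved in time $f(k)\,n^{O(1)}$ for a computable function $f$. (Time is counted in the language WHILE over binary trees, a standard machine model that is polynomially equivalent to Turing machines.) -/

import Mathlib

/-! ### The machine model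

Jones' language WHILE: programs over binary trees with assignment, sequencing, branching and
looping, where every tree operation and every test costs one unit of time. -/

namespace WhileLang

/-- The data: binary trees. -/
inductive Val : Type
  | nil : Val
  | cons : Val → Val → Val

/-- Head of a tree; the head of `nil` is `nil`. -/
def Val.hd : Val → Val
  | .nil => .nil
  | .cons a _ => a

/-- Tail of a tree; the tail of `nil` is `nil`. -/
def Val.tl : Val → Val
  | .nil => .nil
  | .cons _ b => b

/-- A store assigns a tree to every variable; variables are numbered. -/
abbrev Store : Type := ℕ → Val

/-- Expressions. -/
inductive Expr : Type
  | var : ℕ → Expr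
  | nil : Expr
  | cons : Expr → Expr → Expr
  | hd : Expr → Expr
  | tl : Expr → Expr

/-- Value of an expression. -/
def Expr.eval (σ : Store) : Expr → Val
  | .var x => σ x
  | .nil => .nil
  | .cons a b => .cons (a.eval σ) (b.eval σ)
  | .hd a => (a.eval σ).hd
  | .tl a => (a.eval σ).tl

/-- Time to evaluate an expression: one unit for each symbol in it. -/
def Expr.cost : Expr → ℕ
  | .var _ => 1
  | .nil => 1
  | .cons a b => a.cost + b.cost + 1
  | .hd a => a.cost + 1
  | .tl a => a.cost + 1

/-- Programs. Tests ask whether the value of an expression differs from `nil`. -/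
inductive Prog : Type
  | assign : ℕ → Expr → Prog
  | seq : Prog → Prog → Prog
  | ite : Expr → Prog → Prog → Prog
  | loop : Expr → Prog → Prog

/-- `Exec p σ σ' t`: started in the store `σ`, the program `p` terminates in the store `σ'` after
exactly `t` units of time. -/
inductive Exec : Prog → Store → Store → ℕ → Prop
  | assign (x : ℕ) (e : Expr) (σ : Store) :
      Exec (.assign x e) σ (Function.update σ x (e.eval σ)) (e.cost + 1)
  | seq {p q : Prog} {σ σ' σ'' : Store} {t t' : ℕ} :
      Exec p σ σ' t → Exec q σ' σ'' t' → Exec (.seq p q) σ σ'' (t + t')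
  | ite_true {e : Expr} {p q : Prog} {σ σ' : Store} {t : ℕ} :
      e.eval σ ≠ .nil → Exec p σ σ' t → Exec (.ite e p q) σ σ' (e.cost + 1 + t)
  | ite_false {e : Expr} {p q : Prog} {σ σ' : Store} {t : ℕ} :
      e.eval σ = .nil → Exec q σ σ' t → Exec (.ite e p q) σ σ' (e.cost + 1 + t)
  | loop_done {e : Expr} {p : Prog} {σ : Store} :
      e.eval σ = .nil → Exec (.loop e p) σ σ (e.cost + 1)
  | loop_step {e : Expr} {p : Prog} {σ σ' σ'' : Store} {t t' : ℕ} :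
      e.eval σ ≠ .nil → Exec p σ σ' t → Exec (.loop e p) σ' σ'' t' →
        Exec (.loop e p) σ σ'' (e.cost + 1 + t + t')

/-- The initial store: the input is in variable `0`, every other variable holds `nil`. -/
def Store.init (v : Val) : Store := fun x => if x = 0 then v else .nil

/-- On input `v`, the program `p` halts within time `T`, with output `w` in variable `0`. -/
def Prog.OutputsWithin (p : Prog) (v w : Val) (T : ℕ) : Prop :=
  ∃ (σ : Store) (t : ℕ), Exec p (Store.init v) σ t ∧ σ 0 = w ∧ t ≤ T

/-- A list of trees as a tree. -/
def encList : List Val → Val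
  | [] => .nil
  | a :: l => .cons a (encList l)

/-- Truth values: `false` is `nil`, `true` is any fixed other tree. -/
def encBool : Bool → Val
  | false => .nil
  | true => .cons .nil .nil

/-- Numbers in unary. -/
def encNat (k : ℕ) : Val := encList (List.replicate k .nil)

/-- A subset of an `n`-element universe, as its characteristic vector of length `n`. -/
def encSet {n : ℕ} (s : Finset (Fin n)) : Val :=
  encList ((List.finRange n).map fun u => encBool (decide (u ∈ s)))

end WhileLang

/-! ### Overlap constraints and set packings -/

namespace SetPacking

open WhileLang

/-- `𝒰ʳ`: the subsets of size at most `r` of the universe `{0, …, n - 1}`. -/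
abbrev SmallSet (n r : ℕ) : Type := {s : Finset (Fin n) // s.card ≤ r}

/-- An overlap constraint for sets of size at most `r`: a class of nonempty finite universes, indexed
by `ι`, where the universe `i` has `size i` elements and possibly carries further data `descr i`
(weights of the elements, a graph on them, …), together with a function
`α : 𝒰ʳ × 𝒰ʳ → {0, 1}` on each of them. -/
structure OverlapConstraint (ι : Type*) (r : ℕ) where
  size : ι → ℕ
  size_pos : ∀ i, 0 < size i
  descr : ι → Val
  α : (i : ι) → SmallSet (size i) r → SmallSet (size i) r → Bool

namespace OverlapConstraint

variable {ι : Type*} {r : ℕ}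

/-- Subsets of sets that do not conflict do not conflict. -/
def Hereditary (A : OverlapConstraint ι r) : Prop :=
  ∀ (i : ι) (s t : SmallSet (A.size i) r), A.α i s t = false →
    ∀ s' t' : SmallSet (A.size i) r, s'.1 ⊆ s.1 → t'.1 ⊆ t.1 → A.α i s' t' = false

/-- Conflicting sets overlap, and passing to subsets that do not conflict removes an element of the
overlap. -/
def HasConflictingElements (A : OverlapConstraint ι r) : Prop :=
  ∀ (i : ι) (s t : SmallSet (A.size i) r), A.α i s t = true →
    1 ≤ (s.1 ∩ t.1).card ∧
    ∀ s' t' : SmallSet (A.size i) r, s'.1 ⊆ s.1 → t'.1 ⊆ t.1 → A.α i s' t' = false →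
      (s.1 ∩ t.1) \ (s'.1 ∩ t'.1) ≠ ∅

/-- `α` is computable in time `O(n ^ d)`, by one program for all universes of the class. -/
def ComputableWithExponent (A : OverlapConstraint ι r) (d : ℕ) : Prop :=
  ∃ (p : Prog) (B : ℕ), ∀ (i : ι) (s t : SmallSet (A.size i) r),
    p.OutputsWithin (.cons (A.descr i) (.cons (encSet s.1) (encSet t.1)))
      (encBool (A.α i s t)) (B * A.size i ^ d)

/-- `α` is well-conditioned, where `d` is the exponent of its polynomial running time. -/
structure WellConditioned (A : OverlapConstraint ι r) (d : ℕ) : Prop where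
  hereditary : A.Hereditary
  conflicting : A.HasConflictingElements
  computable : A.ComputableWithExponent d

/-- The collection `S` contains a `(k, α)`-set packing: at least `k` distinct members such that
no two of them conflict. -/
def HasPacking (A : OverlapConstraint ι r) (i : ι) (S : Finset (SmallSet (A.size i) r)) (k : ℕ) :
    Prop :=
  ∃ K : Finset (SmallSet (A.size i) r), K ⊆ S ∧ k ≤ K.card ∧
    ∀ s ∈ K, ∀ t ∈ K, s ≠ t → A.α i s t = false

/-- An input of `r`-Set Packing with `α`-Overlap: the universe, the members of the collection in
some order, and the number `k`. -/
def encInstance (A : OverlapConstraint ι r) (i : ι) (L : List (SmallSet (A.size i) r)) (k : ℕ) :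
    Val :=
  .cons (A.descr i) (.cons (encList (L.map fun s => encSet s.1)) (encNat k))

/-- `r`-Set Packing with `α`-Overlap can be solved in time `O(T n k)`, where `n` is the number of
elements of the universe: one program, given any repetition-free listing of the collection, decides
whether there is a `(k, α)`-set packing. -/
def SolvableInTime (A : OverlapConstraint ι r) (T : ℕ → ℕ → ℕ) : Prop :=
  ∃ (p : Prog) (C : ℕ), ∀ (i : ι) (L : List (SmallSet (A.size i) r)) (k : ℕ), L.Nodup →
    ∃ b : Bool, (b = true ↔ A.HasPacking i L.toFinset k) ∧
      p.OutputsWithin (A.encInstance i L k) (encBool b) (C * T (A.size i) k)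

/-- `r`-Set Packing with `α`-Overlap, with parameter `k`, is fixed-parameter tractable: it can be
solved in time `f k * n ^ O(1)` for a computable function `f`. -/
def FixedParameterTractable (A : OverlapConstraint ι r) : Prop :=
  ∃ f : ℕ → ℕ, Computable f ∧ ∃ e : ℕ, A.SolvableInTime fun n k => f k * n ^ e

end OverlapConstraint

end SetPacking

/-! ### Subroutine calls -/

namespace WhileLang

/-! Kernelize, then search exhaustively. Put `q = (r + 1) * k` and go through the collection,
keeping a set `s` only if each `c ⊆ s` has fewer than `q ^ (r - |c|)` kept supersets (`kernel`).
With `c = ∅` this leaves at most `q ^ r` sets. If `s` is rejected, some `c ⊆ s` has at least `q ^ (r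
- |c|)` kept supersets. When `s` lies in a packing of size `k`, the other members meet too few of
these outside `c` to spoil them all, so some kept `t ⊇ c` meets the other members only inside `c`.
Such a `t` can replace `s`: by heredity no other member `w` conflicts with `c`, so a conflict of `w`
and `t` would, by condition (ii), produce a common element outside `c`. This exchange is
`exists_packing_kernel`, fed by `exists_mem_of_not_ok`; repeating it moves the packing into the
kernel.

A branching search then visits at most `(q ^ r + 1) ^ k` partial packings
(`length_partialPackings_le`). For fixed `r` this is `k ^ (r * k)` up to a factor exponential in
`k`, which the spare factor `k ^ k` absorbs (`pow_le_pow_self_mul`, `time_le`).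

The programs are assembled without writing code for each one: `Runs D F T` says that a single
program computes `F` from `D` in time `O(T + 1)`, and it is closed under composition, pairing,
branching and folds. The case `r = 0` is separate, since there the bound does not depend on `n`. -/

/-- Rename every variable `x` to `N + x`. -/
def Expr.shift (N : ℕ) : Expr → Expr
  | .var x => .var (N + x)
  | .nil => .nil
  | .cons a b => .cons (a.shift N) (b.shift N)
  | .hd a => .hd (a.shift N)
  | .tl a => .tl (a.shift N)

/-- A strict upper bound for the variables of an expression. -/
def Expr.varBound : Expr → ℕ
  | .var x => x + 1
  | .nil => 0
  | .cons a b => max a.varBound b.varBound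
  | .hd a => a.varBound
  | .tl a => a.varBound

/-- Rename every variable `x` to `N + x`. -/
def Prog.shift (N : ℕ) : Prog → Prog
  | .assign x e => .assign (N + x) (e.shift N)
  | .seq p q => .seq (p.shift N) (q.shift N)
  | .ite e p q => .ite (e.shift N) (p.shift N) (q.shift N)
  | .loop e p => .loop (e.shift N) (p.shift N)

/-- A strict upper bound for the variables of a program. -/
def Prog.varBound : Prog → ℕ
  | .assign x e => max (x + 1) e.varBound
  | .seq p q => max p.varBound q.varBound
  | .ite e p q => max e.varBound (max p.varBound q.varBound)
  | .loop e p => max e.varBound p.varBound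

@[simp]
theorem Expr.cost_shift (N : ℕ) (e : Expr) : (e.shift N).cost = e.cost := by
  induction e <;> simp_all [Expr.shift, Expr.cost]

theorem Expr.eval_shift {N M : ℕ} {σ τ : Store} (h : ∀ x < M, σ (N + x) = τ x) (e : Expr)
    (he : e.varBound ≤ M) : (e.shift N).eval σ = e.eval τ := by
  induction e with
  | var x => exact h x (by simpa [Expr.varBound] using he)
  | nil => rfl
  | cons a b iha ihb =>
    simp only [Expr.varBound, max_le_iff] at he
    simp [Expr.shift, Expr.eval, iha he.1, ihb he.2]
  | hd a ih => simp [Expr.shift, Expr.eval, ih he]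
  | tl a ih => simp [Expr.shift, Expr.eval, ih he]

/-- A renamed program simulates the original one and leaves the variables below the offset
unchanged. -/
theorem Exec.shift {p : Prog} {τ τ' : Store} {t : ℕ} (h : Exec p τ τ' t) (N M : ℕ)
    (hM : p.varBound ≤ M) (σ : Store) (hσ : ∀ x < M, σ (N + x) = τ x) :
    ∃ σ', Exec (p.shift N) σ σ' t ∧ (∀ x < M, σ' (N + x) = τ' x) ∧ ∀ x < N, σ' x = σ x := by
  induction h generalizing σ with
  | assign x e τ =>
    simp only [Prog.varBound, max_le_iff] at hM
    refine ⟨_, by simpa [Prog.shift] using Exec.assign (N + x) (e.shift N) σ, fun y hy => ?_,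
      fun y hy => ?_⟩
    · rw [Expr.eval_shift hσ e hM.2]
      by_cases hxy : y = x
      · subst hxy; simp
      · rw [Function.update_of_ne (by omega), Function.update_of_ne hxy, hσ y hy]
    · rw [Function.update_of_ne (by omega)]
  | seq _ _ ih₁ ih₂ =>
    simp only [Prog.varBound, max_le_iff] at hM
    obtain ⟨σ₁, h₁, h₁', h₁''⟩ := ih₁ hM.1 σ hσ
    obtain ⟨σ₂, h₂, h₂', h₂''⟩ := ih₂ hM.2 σ₁ h₁'
    exact ⟨σ₂, .seq h₁ h₂, h₂', fun x hx => (h₂'' x hx).trans (h₁'' x hx)⟩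
  | @ite_true e p q _ _ _ he _ ih =>
    simp only [Prog.varBound, max_le_iff] at hM
    obtain ⟨σ₁, h₁, h₁', h₁''⟩ := ih hM.2.1 σ hσ
    refine ⟨σ₁, ?_, h₁', h₁''⟩
    rw [← Expr.cost_shift N e]
    exact .ite_true (by rwa [Expr.eval_shift hσ e hM.1]) h₁
  | @ite_false e p q _ _ _ he _ ih =>
    simp only [Prog.varBound, max_le_iff] at hM
    obtain ⟨σ₁, h₁, h₁', h₁''⟩ := ih hM.2.2 σ hσ
    refine ⟨σ₁, ?_, h₁', h₁''⟩
    rw [← Expr.cost_shift N e]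
    exact .ite_false (by rwa [Expr.eval_shift hσ e hM.1]) h₁
  | @loop_done e p _ he =>
    simp only [Prog.varBound, max_le_iff] at hM
    refine ⟨σ, ?_, hσ, fun _ _ => rfl⟩
    rw [← Expr.cost_shift N e]
    exact .loop_done (by rwa [Expr.eval_shift hσ e hM.1])
  | @loop_step e p _ _ _ _ _ he _ _ ih₁ ih₂ =>
    have hM' := hM
    simp only [Prog.varBound, max_le_iff] at hM
    obtain ⟨σ₁, h₁, h₁', h₁''⟩ := ih₁ hM.2 σ hσ
    obtain ⟨σ₂, h₂, h₂', h₂''⟩ := ih₂ hM' σ₁ h₁'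
    refine ⟨σ₂, ?_, h₂', fun x hx => (h₂'' x hx).trans (h₁'' x hx)⟩
    rw [← Expr.cost_shift N e]
    exact .loop_step (by rwa [Expr.eval_shift hσ e hM.1]) h₁ h₂

/-- Started in `σ`, the program `p` halts within time `T` in a store that satisfies `Q`. -/
def Prog.Reaches (p : Prog) (σ : Store) (T : ℕ) (Q : Store → Prop) : Prop :=
  ∃ (σ' : Store) (t : ℕ), Exec p σ σ' t ∧ Q σ' ∧ t ≤ T

theorem Prog.Reaches.mono {p : Prog} {σ : Store} {T T' : ℕ} {Q Q' : Store → Prop}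
    (h : p.Reaches σ T Q) (hT : T ≤ T') (hQ : ∀ σ', Q σ' → Q' σ') : p.Reaches σ T' Q' := by
  obtain ⟨σ', t, h, hq, ht⟩ := h
  exact ⟨σ', t, h, hQ _ hq, ht.trans hT⟩

theorem Prog.Reaches.assign {x : ℕ} {e : Expr} {σ : Store} {Q : Store → Prop}
    (h : Q (Function.update σ x (e.eval σ))) : (Prog.assign x e).Reaches σ (e.cost + 1) Q :=
  ⟨_, _, .assign x e σ, h, le_rfl⟩

theorem Prog.Reaches.seq {p q : Prog} {σ : Store} {T T' : ℕ} {Q : Store → Prop}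
    (h : p.Reaches σ T fun σ' => q.Reaches σ' T' Q) : (Prog.seq p q).Reaches σ (T + T') Q := by
  obtain ⟨σ', t, h, ⟨σ'', t', h', hq, ht'⟩, ht⟩ := h
  exact ⟨σ'', _, .seq h h', hq, by omega⟩

/-- Set the variables `N + 1, …, N + m` to `nil`. -/
def Prog.clear (N : ℕ) : ℕ → Prog
  -- WHILE has no empty program; assigning a variable to itself serves as one.
  | 0 => .assign N (.var N)
  | m + 1 => .seq (Prog.clear N m) (.assign (N + (m + 1)) .nil)

theorem Prog.reaches_clear (N m : ℕ) (σ : Store) :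
    (Prog.clear N m).Reaches σ (2 * m + 2) fun σ' =>
      (∀ x, 0 < x → x ≤ m → σ' (N + x) = .nil) ∧ ∀ x ≤ N, σ' x = σ x := by
  induction m with
  | zero =>
    refine (Prog.Reaches.assign ?_).mono (by simp [Expr.cost]) (fun _ h => h)
    refine ⟨fun x _ _ => by omega, fun x _ => ?_⟩
    simp [Expr.eval]
  | succ m ih =>
    refine (Prog.Reaches.seq (T' := 2) (ih.mono le_rfl fun σ' h => ?_)).mono (by omega)
      (fun _ h => h)
    refine (Prog.Reaches.assign ?_).mono (by simp [Expr.cost]) (fun _ h => h)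
    refine ⟨fun x hx hxm => ?_, fun x hx => ?_⟩
    · by_cases hx' : x = m + 1
      · subst hx'; simp [Expr.eval]
      · rw [Function.update_of_ne (by omega)]
        exact h.1 x hx (by omega)
    · rw [Function.update_of_ne (by omega)]
      exact h.2 x hx

/-- Run `p` as a subroutine on the value of the variable `N`, which also receives the result.
Only variables from `N` on are changed. -/
def Prog.callAt (p : Prog) (N : ℕ) : Prog := .seq (Prog.clear N p.varBound) (p.shift N)

/-- `OutputsWithin` speaks only of the initial store, so a call must recreate it: clearing the
scratch variables costs a constant depending on `p` alone. The variables below `N` act as a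
protected frame of the caller. -/
theorem Prog.OutputsWithin.reaches_callAt {p : Prog} {v w : Val} {T : ℕ}
    (h : p.OutputsWithin v w T) {N : ℕ} {σ : Store} (hσ : σ N = v) :
    (p.callAt N).Reaches σ (T + (2 * p.varBound + 2)) fun σ' =>
      σ' N = w ∧ ∀ x < N, σ' x = σ x := by
  obtain ⟨τ, t, hp, hw, ht⟩ := h
  rw [add_comm]
  refine Prog.Reaches.seq ((Prog.reaches_clear N p.varBound σ).mono le_rfl fun σ₁ h₁ => ?_)
  obtain ⟨σ₂, h₂, h₂', h₂''⟩ := hp.shift N (p.varBound + 1) (by omega) σ₁ (fun x hx => by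
    rcases Nat.eq_zero_or_pos x with rfl | hx0
    · simp [Store.init, h₁.2, hσ]
    · rw [h₁.1 x hx0 (by omega)]
      simp [Store.init, hx0.ne'])
  exact ⟨σ₂, t, h₂, ⟨by simpa [hw] using h₂' 0 (by omega),
    fun x hx => (h₂'' x hx).trans (h₁.2 x hx.le)⟩, ht⟩

/-! ### A calculus of running times -/

/-- One program turns `D x` into `F x` in time `O(T x + 1)`, for all indices `x`. -/
def Runs {X : Type*} (D F : X → Val) (T : X → ℕ) : Prop :=
  ∃ (p : Prog) (C : ℕ), ∀ x, p.OutputsWithin (D x) (F x) (C * (T x + 1))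

namespace Runs

universe u v
variable {X : Type u} {D E F G : X → Val} {T T' : X → ℕ}

theorem mono (h : Runs D F T) (K : ℕ) (hT : ∀ x, T x ≤ K * (T' x + 1)) : Runs D F T' := by
  obtain ⟨p, C, h⟩ := h
  refine ⟨p, C * (K + 1), fun x => ?_⟩
  obtain ⟨σ, t, h₁, h₂, h₃⟩ := h x
  refine ⟨σ, t, h₁, h₂, h₃.trans ?_⟩
  rw [mul_assoc]
  refine Nat.mul_le_mul_left _ ?_
  have := hT x
  nlinarith

theorem of_le (h : Runs D F T) (hT : ∀ x, T x ≤ T' x) : Runs D F T' :=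
  h.mono 1 fun x => by have := hT x; omega

theorem congr (h : Runs D F T) (hF : ∀ x, F x = G x) : Runs D G T := by
  rwa [← funext hF]

theorem comap {Y : Type v} (h : Runs D F T) (g : Y → X) :
    Runs (fun y => D (g y)) (fun y => F (g y)) (fun y => T (g y)) := by
  obtain ⟨p, C, h⟩ := h
  exact ⟨p, C, fun y => h (g y)⟩

/-- Evaluation of an expression in the variable `0`. -/
theorem of_expr (e : Expr) (h : ∀ x, e.eval (Store.init (D x)) = F x) : Runs D F fun _ => 0 :=
  ⟨.assign 0 e, e.cost + 1, fun x => by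
    refine (Prog.Reaches.assign (Q := fun σ => σ 0 = F x) ?_).mono (by simp) (fun _ h => h)
    simp [h]⟩

theorem refl : Runs D D fun _ => 0 := of_expr (.var 0) fun _ => rfl

theorem const (v : Val) : Runs D (fun _ => v) fun _ => 0 := by
  have : ∃ e : Expr, ∀ σ, e.eval σ = v := by
    induction v with
    | nil => exact ⟨.nil, fun _ => rfl⟩
    | cons a b iha ihb =>
      obtain ⟨ea, ha⟩ := iha
      obtain ⟨eb, hb⟩ := ihb
      exact ⟨.cons ea eb, fun σ => by simp [Expr.eval, ha, hb]⟩
  obtain ⟨e, he⟩ := this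
  exact of_expr e fun _ => he _

theorem trans (h₁ : Runs D E T) (h₂ : Runs E F T') : Runs D F fun x => T x + T' x := by
  obtain ⟨p, C, hp⟩ := h₁
  obtain ⟨q, C', hq⟩ := h₂
  refine ⟨.seq p (q.callAt 0), C + C' + (2 * q.varBound + 2), fun x => ?_⟩
  refine (Prog.Reaches.seq (Q := fun σ => σ 0 = F x) (Prog.Reaches.mono (hp x) le_rfl
    fun σ hσ => ((hq x).reaches_callAt hσ).mono le_rfl fun _ h => h.1)).mono ?_ (fun _ h => h)
  nlinarith [Nat.zero_le (C * T' x), Nat.zero_le (C' * T x), Nat.zero_le (q.varBound * T x),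
    Nat.zero_le (q.varBound * T' x)]

theorem hd (h : Runs D F T) : Runs D (fun x => (F x).hd) T :=
  (h.trans (of_expr (.hd (.var 0)) fun _ => rfl)).of_le fun _ => le_rfl

theorem tl (h : Runs D F T) : Runs D (fun x => (F x).tl) T :=
  (h.trans (of_expr (.tl (.var 0)) fun _ => rfl)).of_le fun _ => le_rfl

theorem cons (hF : Runs D F T) (hG : Runs D G T') :
    Runs D (fun x => .cons (F x) (G x)) fun x => T x + T' x := by
  obtain ⟨p, C, hp⟩ := hF
  obtain ⟨q, C', hq⟩ := hG
  -- Each call starts at the first free variable: variable `0` keeps the input for the second call,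
  -- and variable `1` keeps the first result while the second is computed.
  refine ⟨.seq (.assign 1 (.var 0)) (.seq (p.callAt 1) (.seq (.assign 2 (.var 0))
    (.seq (q.callAt 2) (.assign 0 (.cons (.var 1) (.var 2)))))),
    C + C' + (2 * p.varBound + 2) + (2 * q.varBound + 2) + 8, fun x => ?_⟩
  refine (Prog.Reaches.seq (Prog.Reaches.assign (Prog.Reaches.seq
    (((hp x).reaches_callAt ?_).mono le_rfl fun σ hσ => Prog.Reaches.seq (Prog.Reaches.assign
      (Prog.Reaches.seq (((hq x).reaches_callAt ?_).mono le_rfl fun σ' hσ' =>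
        Prog.Reaches.assign (Q := fun σ => σ 0 = .cons (F x) (G x)) ?_))))))).mono
      ?_ (fun _ h => h)
  · simp [Expr.eval, Store.init]
  · simp [Expr.eval, Store.init, hσ.2]
  · have := hσ'.2 1 (by omega)
    simp [Expr.eval, hσ'.1, this, hσ.1]
  · simp only [Expr.cost]
    nlinarith [Nat.zero_le (C * T' x), Nat.zero_le (C' * T x), Nat.zero_le (q.varBound * T x),
      Nat.zero_le (q.varBound * T' x), Nat.zero_le (p.varBound * T' x),
      Nat.zero_le (p.varBound * T x)]

/-- Call of a subroutine whose running time is known for another family of inputs. -/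
theorem call {Y : Type v} {D' F' : Y → Val} {S : Y → ℕ} (h : Runs D' F' S) (g : X → Y)
    (hg : Runs D (fun x => D' (g x)) T) : Runs D (fun x => F' (g x)) fun x => T x + S (g x) :=
  hg.trans (h.comap g)

theorem ite_of_iff {b : X → Bool} (hb : Runs D E T) (hE : ∀ x, b x = false ↔ E x = .nil)
    (hF : Runs D F T') (hG : Runs D G T') :
    Runs D (fun x => if b x then F x else G x) fun x => T x + T' x := by
  obtain ⟨p, C, hp⟩ := hF
  obtain ⟨q, C', hq⟩ := hG
  obtain ⟨s, C'', hs⟩ := hb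
  refine ⟨.seq (.assign 1 (.var 0)) (.seq (s.callAt 1) (.ite (.var 1) (p.callAt 0) (q.callAt 0))),
    C + C' + C'' + (2 * p.varBound + 2) + (2 * q.varBound + 2) + (2 * s.varBound + 2) + 8,
    fun x => ?_⟩
  refine (Prog.Reaches.seq (Prog.Reaches.assign (Prog.Reaches.seq
    (T' := 2 + (C + C') * (T' x + 1) + (2 * p.varBound + 2) + (2 * q.varBound + 2))
    (((hs x).reaches_callAt ?_).mono le_rfl fun σ hσ => ?_)))).mono ?_ (fun _ h => h)
  · simp [Expr.eval, Store.init]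
  · have h0 : σ 0 = D x := by rw [hσ.2 0 (by omega)]; simp [Store.init]
    cases hbx : b x with
    | true =>
      obtain ⟨σ', t, h₁, h₂, h₃⟩ := (hp x).reaches_callAt h0
      refine ⟨σ', _, .ite_true (by simp [Expr.eval, hσ.1, ← hE, hbx]) h₁, by simp [h₂.1, hbx], ?_⟩
      simp only [Expr.cost]
      nlinarith [Nat.zero_le (C' * T' x)]
    | false =>
      obtain ⟨σ', t, h₁, h₂, h₃⟩ := (hq x).reaches_callAt h0
      refine ⟨σ', _, .ite_false (by simp [Expr.eval, hσ.1, ← hE, hbx]) h₁, by simp [h₂.1, hbx], ?_⟩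
      simp only [Expr.cost]
      nlinarith [Nat.zero_le (C * T' x)]
  · simp only [Expr.cost]
    nlinarith [Nat.zero_le (C * T x), Nat.zero_le (C' * T x), Nat.zero_le (C'' * T' x),
      Nat.zero_le (q.varBound * T x), Nat.zero_le (s.varBound * T x),
      Nat.zero_le (s.varBound * T' x),
      Nat.zero_le (q.varBound * T' x), Nat.zero_le (p.varBound * T x),
      Nat.zero_le (p.varBound * T' x)]

theorem ite {b : X → Bool} (hb : Runs D (fun x => encBool (b x)) T) (hF : Runs D F T')
    (hG : Runs D G T') :
    Runs D (fun x => if b x then F x else G x) fun x => T x + T' x :=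
  ite_of_iff hb (fun x => by cases b x <;> simp [encBool]) hF hG

/-- Iteration over a list. The body is only charged for states that occur. -/
theorem foldl {A S : X → Type*} (encA : ∀ x, A x → Val) (encS : ∀ x, S x → Val)
    (l : ∀ x, List (A x)) (init : ∀ x, S x) (step : ∀ x, S x → A x → S x)
    {R : (Σ x, A x × S x) → ℕ} (T₁ : X → ℕ)
    (hl : Runs D (fun x => encList ((l x).map (encA x))) T)
    (hi : Runs D (fun x => encS x (init x)) T')
    (hs : Runs (fun y : Σ x, A x × S x => .cons (encA y.1 y.2.1) (.cons (encS y.1 y.2.2) (D y.1)))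
      (fun y => encS y.1 (step y.1 y.2.2 y.2.1)) R)
    (hR : ∀ x (l₁ : List (A x)) a l₂, l x = l₁ ++ a :: l₂ →
      R ⟨x, a, l₁.foldl (step x) (init x)⟩ ≤ T₁ x) :
    Runs D (fun x => encS x ((l x).foldl (step x) (init x)))
      fun x => T x + T' x + (l x).length * (T₁ x + 1) := by
  obtain ⟨p, C, hp⟩ := hl
  obtain ⟨q, C', hq⟩ := hi
  obtain ⟨s, C'', hs⟩ := hs
  -- Variable `0` holds the input, `1` the rest of the list, `2` the accumulated state, and `3`
  -- starts the frame of the step subroutine.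
  let body : Prog := .seq (.assign 3 (.cons (.hd (.var 1)) (.cons (.var 2) (.var 0))))
    (.seq (s.callAt 3) (.seq (.assign 2 (.var 3)) (.assign 1 (.tl (.var 1)))))
  let c : ℕ := C'' + (2 * s.varBound + 2) + 15
  have loop : ∀ x (l₂ l₁ : List (A x)) (σ : Store), l x = l₁ ++ l₂ → σ 0 = D x →
      σ 1 = encList (l₂.map (encA x)) → σ 2 = encS x (l₁.foldl (step x) (init x)) →
      (Prog.loop (.var 1) body).Reaches σ (l₂.length * (c * (T₁ x + 1)) + 2)
        fun σ' => σ' 2 = encS x ((l x).foldl (step x) (init x)) := by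
    intro x l₂
    induction l₂ with
    | nil =>
      intro l₁ σ hl h0 h1 h2
      exact ⟨σ, _, .loop_done (by simpa [Expr.eval, encList] using h1), by simp [h2, hl],
        by simp [Expr.cost]⟩
    | cons a l₂ ih =>
      intro l₁ σ hl h0 h1 h2
      have hb : body.Reaches σ (C'' * (T₁ x + 1) + (2 * s.varBound + 2) + 13) fun σ' =>
          σ' 0 = D x ∧ σ' 1 = encList (l₂.map (encA x)) ∧
          σ' 2 = encS x ((l₁ ++ [a]).foldl (step x) (init x)) := by
        have hsx := hs ⟨x, a, l₁.foldl (step x) (init x)⟩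
        refine (Prog.Reaches.seq (Prog.Reaches.assign (Prog.Reaches.seq
          ((hsx.reaches_callAt ?_).mono le_rfl fun σ' hσ' => Prog.Reaches.seq
            (Prog.Reaches.assign (Prog.Reaches.assign ?_)))))).mono ?_ (fun _ h => h)
        · simp [Expr.eval, h0, h1, h2, encList, Val.hd]
        · have e0 := hσ'.2 0 (by omega)
          have e1 := hσ'.2 1 (by omega)
          simp [Expr.eval, h0, h1, encList, Val.tl, e0, e1, hσ'.1]
        · have := Nat.mul_le_mul_left C'' (Nat.add_le_add_right (hR x l₁ a l₂ hl) 1)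
          simp only [Expr.cost]
          omega
      obtain ⟨σ', t, he, ⟨h0', h1', h2'⟩, ht⟩ := hb
      obtain ⟨σ'', t', he', hq', ht'⟩ := ih (l₁ ++ [a]) σ' (by simp [hl]) h0' h1' h2'
      refine ⟨σ'', _, .loop_step (by simp [Expr.eval, h1, encList]) he he', hq', ?_⟩
      simp only [Expr.cost, List.length_cons, c] at ht' ⊢
      nlinarith [Nat.zero_le (s.varBound * T₁ x)]
  refine ⟨.seq (.assign 1 (.var 0)) (.seq (p.callAt 1) (.seq (.assign 2 (.var 0))
    (.seq (q.callAt 2) (.seq (.loop (.var 1) body) (.assign 0 (.var 2)))))),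
    C + C' + (2 * p.varBound + 2) + (2 * q.varBound + 2) + c + 8, fun x => ?_⟩
  refine (Prog.Reaches.seq (Prog.Reaches.assign (Prog.Reaches.seq
    (((hp x).reaches_callAt ?_).mono le_rfl fun σ hσ => Prog.Reaches.seq (Prog.Reaches.assign
      (Prog.Reaches.seq (((hq x).reaches_callAt ?_).mono le_rfl fun σ' hσ' =>
        Prog.Reaches.seq ((loop x (l x) [] σ' (by simp) ?_ ?_ ?_).mono le_rfl fun σ'' hσ'' =>
        Prog.Reaches.assign (Q := fun σ => σ 0 = encS x ((l x).foldl (step x) (init x)))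
          ?_)))))))).mono ?_ (fun _ h => h)
  · simp [Expr.eval, Store.init]
  · simp [Expr.eval, Store.init, hσ.2]
  · rw [hσ'.2 0 (by omega)]
    simp [hσ.2, Store.init]
  · rw [hσ'.2 1 (by omega)]
    simp [hσ.1]
  · simp [hσ'.1]
  · simp [Expr.eval, hσ'']
  · simp only [Expr.cost]
    have e : (l x).length * (c * (T₁ x + 1)) = c * ((l x).length * (T₁ x + 1)) := by ring
    rw [e]
    generalize (l x).length * (T₁ x + 1) = W
    generalize T x = a
    generalize T' x = b
    generalize p.varBound = P
    generalize q.varBound = Q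
    generalize c = c
    have key : (C + C' + (2 * P + 2) + (2 * Q + 2) + c + 8) * (a + b + W + 1) =
      C * (a + 1) + C' * (b + 1) + c * W + (2 * P + 2) + (2 * Q + 2) + c + 8 +
      (C * (b + W) + C' * (a + W) + ((2 * P + 2) + (2 * Q + 2) + 8) * (a + b + W) + c * (a + b))
        := by ring
    rw [key]
    omega

end Runs

end WhileLang

namespace WhileLang

/-! ### Programs on Booleans, numbers and lists -/

@[simp]
theorem Val.hd_cons (a b : Val) : (Val.cons a b).hd = a := rfl

@[simp]
theorem Val.tl_cons (a b : Val) : (Val.cons a b).tl = b := rfl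

theorem hd_encList_map {A : Type*} (enc : A → Val) (l : List A) (d : A) (hd : enc d = .nil) :
    (encList (l.map enc)).hd = enc (l.headD d) := by
  cases l <;> simp [encList, Val.hd, hd]

@[simp]
theorem tl_encList_map {A : Type*} (enc : A → Val) (l : List A) :
    (encList (l.map enc)).tl = encList (l.tail.map enc) := by
  cases l <;> simp [encList, Val.tl]

theorem tl_encNat (k : ℕ) : (encNat k).tl = encNat (k - 1) := by
  cases k <;> simp [encNat, encList, Val.tl, List.replicate_succ]

theorem encNat_eq_nil {k : ℕ} : encNat k = .nil ↔ k = 0 := by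
  cases k <;> simp [encNat, encList, List.replicate_succ]

theorem encNat_eq (k : ℕ) : encNat k = encList ((List.replicate k ()).map fun _ => .nil) := by
  simp [encNat]

/-- The branching step of a breadth-first search: every state `z` is replaced by `g z a` and,
if `c z a` holds, also by `h z a`. -/
def branch {A S : Type*} (g h : S → A → S) (c : S → A → Bool) (Z : List S) (a : A) : List S :=
  Z.flatMap fun z => g z a :: if c z a then [h z a] else []

/-- The maximum of `f` over a list. -/
def maxOn {A : Type*} (f : A → ℕ) (l : List A) : ℕ := (l.map f).foldr max 0

theorem le_maxOn {A : Type*} (f : A → ℕ) {l : List A} {a : A} (ha : a ∈ l) : f a ≤ maxOn f l := by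
  induction l with
  | nil => simp at ha
  | cons b l ih =>
    rcases List.mem_cons.1 ha with rfl | h
    · simp [maxOn]
    · exact (ih h).trans (by simp [maxOn])

theorem maxOn_le {A : Type*} {f : A → ℕ} {l : List A} {N : ℕ} (h : ∀ a ∈ l, f a ≤ N) :
    maxOn f l ≤ N := by
  induction l with
  | nil => simp [maxOn]
  | cons b l ih =>
    have := ih fun a ha => h a (by simp [ha])
    simp only [maxOn, List.map_cons, List.foldr_cons, max_le_iff] at this ⊢
    exact ⟨h b (by simp), this⟩

namespace Runs

universe u
variable {X : Type u} {D F G : X → Val} {T T' : X → ℕ}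

theorem and {b c : X → Bool} (hb : Runs D (fun x => encBool (b x)) T)
    (hc : Runs D (fun x => encBool (c x)) T') :
    Runs D (fun x => encBool (b x && c x)) fun x => T x + T' x :=
  (hb.ite hc ((const (encBool false)).of_le fun _ => Nat.zero_le _)).congr fun x => by
    cases b x <;> simp

theorem not {b : X → Bool} (hb : Runs D (fun x => encBool (b x)) T) :
    Runs D (fun x => encBool (!b x)) T :=
  (hb.ite (const (encBool false)) (const (encBool true))).congr fun x => by cases b x <;> simp

theorem bool_of_iff {b : X → Bool} (hF : Runs D F T) (h : ∀ x, b x = false ↔ F x = .nil) :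
    Runs D (fun x => encBool (b x)) T :=
  (hF.ite_of_iff h (const (encBool true)) (const (encBool false))).congr fun x => by
    cases b x <;> simp

/-- Prepending the reversal of a list. -/
theorem reverseAppend : Runs (fun y : List Val × List Val => .cons (encList y.1) (encList y.2))
    (fun y => encList (y.1.reverse ++ y.2)) fun y => y.1.length := by
  refine ((foldl (A := fun _ => Val) (S := fun _ => List Val) (fun _ => id) (fun _ => encList)
    (fun y => y.1) (fun y => y.2) (fun _ l a => a :: l) (fun _ => 0)
    (refl.hd.congr fun y => by simp [Val.hd]) (refl.tl.congr fun y => by simp [Val.tl])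
    (R := fun _ => 0) ?_ (by simp)).congr ?_).of_le ?_
  · exact (refl.hd.cons refl.tl.hd).congr fun y => by simp [Val.hd, Val.tl, encList]
  · rintro ⟨l, l'⟩
    congr 1
    induction l generalizing l' with
    | nil => rfl
    | cons a l ih => simp [ih]
  · intro y
    simp

theorem reverse : Runs encList (fun l => encList l.reverse) fun l => l.length :=
  ((reverseAppend.call (fun l => (l, [])) (refl.cons (const .nil))).congr fun l => by
    simp).of_le fun l => by simp

/-- Trees grow only at the front, so the pieces are accumulated in reverse and the result is
reversed once at the end. This is why `hR` also charges the length of each piece. -/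
theorem flatMap {A B : X → Type*} (encA : ∀ x, A x → Val) (encB : ∀ x, B x → Val)
    (l : ∀ x, List (A x)) (f : ∀ x, A x → List (B x)) {R : (Σ x, A x) → ℕ} (T₁ : X → ℕ)
    (hl : Runs D (fun x => encList ((l x).map (encA x))) T)
    (hf : Runs (fun y : Σ x, A x => .cons (encA y.1 y.2) (D y.1))
      (fun y => encList ((f y.1 y.2).map (encB y.1))) R)
    (hR : ∀ x, ∀ a ∈ l x, R ⟨x, a⟩ + (f x a).length ≤ T₁ x) :
    Runs D (fun x => encList (((l x).flatMap (f x)).map (encB x)))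
      fun x => T x + (l x).length * (T₁ x + 1) := by
  have h₁ := foldl (S := fun x => List (B x)) encA (fun x l => encList (l.map (encB x))) l
    (fun _ => []) (fun x acc a => (f x a).reverse ++ acc) T₁ hl (const .nil)
    (R := fun y => R ⟨y.1, y.2.1⟩ + (f y.1 y.2.1).length) ?_
    (fun x l₁ a l₂ h => hR x a (by simp [h]))
  · refine ((reverse.call _ (h₁.congr fun x => rfl)).congr fun x => ?_).mono 2 fun x => ?_
    · rw [← List.map_reverse]
      congr 2
      have key : ∀ (l' : List (A x)) acc, l'.foldl (fun acc a => (f x a).reverse ++ acc) acc =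
          (l'.flatMap (f x)).reverse ++ acc := by
        intro l'
        induction l' with
        | nil => simp
        | cons a l' ih => intro acc; simp [ih]
      simp [key]
    · have key : ∀ l' : List (A x), (∀ a ∈ l', (f x a).length ≤ T₁ x) → ∀ acc,
          (l'.foldl (fun acc a => (f x a).reverse ++ acc) acc).length ≤
          l'.length * T₁ x + acc.length := by
        intro l'
        induction l' with
        | nil => simp
        | cons a l' ih =>
          intro h acc
          refine (ih (fun a ha => h a (by simp [ha])) _).trans ?_
          have := h a (by simp)
          simp only [List.length_append, List.length_reverse, List.length_cons]
          nlinarith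
      have := key (l x) (fun a ha => (Nat.le_add_left _ _).trans (hR x a ha)) []
      simp only [List.length_nil, List.length_map] at this ⊢
      nlinarith
  · have hf' := hf.call (fun y : Σ x, A x × List (B x) => ⟨y.1, y.2.1⟩)
      (D := fun y => .cons (encA y.1 y.2.1) (.cons (encList (y.2.2.map (encB y.1))) (D y.1)))
      (T := fun _ => 0) ((refl.hd.cons refl.tl.tl).congr fun y => by simp [Val.hd, Val.tl])
    refine ((reverseAppend.call (fun y : Σ x, A x × List (B x) =>
      ((f y.1 y.2.1).map (encB y.1), y.2.2.map (encB y.1))) (hf'.cons refl.tl.hd)).congr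
      fun y => ?_).of_le fun y => ?_
    · simp
    · simp

theorem all {A : X → Type*} (encA : ∀ x, A x → Val)
    (l : ∀ x, List (A x)) (f : ∀ x, A x → Bool) {R : (Σ x, A x) → ℕ} (T₁ : X → ℕ)
    (hl : Runs D (fun x => encList ((l x).map (encA x))) T)
    (hf : Runs (fun y : Σ x, A x => .cons (encA y.1 y.2) (D y.1))
      (fun y => encBool (f y.1 y.2)) R)
    (hR : ∀ x, ∀ a ∈ l x, R ⟨x, a⟩ ≤ T₁ x) :
    Runs D (fun x => encBool ((l x).all (f x))) fun x => T x + (l x).length * (T₁ x + 1) := by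
  refine ((foldl (S := fun x => Bool) encA (fun x => encBool) l
    (fun _ => true) (fun x acc a => acc && f x a) T₁ hl (const _)
    (R := fun y => R ⟨y.1, y.2.1⟩) ?_
    (fun x l₁ a l₂ h => hR x a (by simp [h]))).congr fun x => ?_).of_le fun x => le_rfl
  · have hf' := hf.call (fun y : Σ x, A x × Bool => ⟨y.1, y.2.1⟩)
      (D := fun y => .cons (encA y.1 y.2.1) (.cons (encBool y.2.2) (D y.1)))
      (T := fun _ => 0) ((refl.hd.cons refl.tl.tl).congr fun y => by simp [Val.hd, Val.tl])
    exact (and (T := fun _ => 0) (b := fun y : Σ x, A x × Bool => y.2.2)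
      (refl.tl.hd.congr fun y => by simp [Val.hd, Val.tl]) hf').of_le fun y => by simp
  · congr 1
    have key : ∀ (l' : List (A x)) acc, l'.foldl (fun acc a => acc && f x a) acc =
        (acc && l'.all (f x)) := by
      intro l'
      induction l' with
      | nil => simp
      | cons a l' ih => intro acc; simp [ih, Bool.and_assoc]
    simp [key]

/-- A breadth-first search with at most two successors of every state. -/
theorem foldl_branch {A S : X → Type*} (encA : ∀ x, A x → Val) (encS : ∀ x, S x → Val)
    (l : ∀ x, List (A x)) (init : ∀ x, List (S x)) (g h : ∀ x, S x → A x → S x)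
    (c : ∀ x, S x → A x → Bool) {R : (Σ x, A x × S x) → ℕ} (N T₁ : X → ℕ)
    (hl : Runs D (fun x => encList ((l x).map (encA x))) T)
    (hi : Runs D (fun x => encList ((init x).map (encS x))) T')
    (hg : Runs (fun y : Σ x, A x × S x => .cons (encA y.1 y.2.1) (.cons (encS y.1 y.2.2) (D y.1)))
      (fun y => encS y.1 (g y.1 y.2.2 y.2.1)) R)
    (hh : Runs (fun y : Σ x, A x × S x => .cons (encA y.1 y.2.1) (.cons (encS y.1 y.2.2) (D y.1)))
      (fun y => encS y.1 (h y.1 y.2.2 y.2.1)) R)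
    (hc : Runs (fun y : Σ x, A x × S x => .cons (encA y.1 y.2.1) (.cons (encS y.1 y.2.2) (D y.1)))
      (fun y => encBool (c y.1 y.2.2 y.2.1)) R)
    (hN : ∀ x (l₁ : List (A x)) a l₂, l x = l₁ ++ a :: l₂ →
      (l₁.foldl (branch (g x) (h x) (c x)) (init x)).length ≤ N x)
    (hR : ∀ x (l₁ : List (A x)) a l₂, l x = l₁ ++ a :: l₂ →
      ∀ z ∈ l₁.foldl (branch (g x) (h x) (c x)) (init x), R ⟨x, a, z⟩ ≤ T₁ x) :
    Runs D (fun x => encList (((l x).foldl (branch (g x) (h x) (c x)) (init x)).map (encS x)))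
      fun x => T x + T' x + (l x).length * ((N x + 1) * (T₁ x + 1)) := by
  refine (foldl (S := fun x => List (S x)) encA (fun x Z => encList (Z.map (encS x))) l init
    (fun x => branch (g x) (h x) (c x)) (fun x => N x * (3 * T₁ x + 3)) hl hi
    -- The cost of a step must be declared for every list of states, also for lists that never
    -- occur, so it uses the maximum over the list; only afterwards do `hN` and `hR` bound it by `N`
    -- and `T₁`. The factor `3` stands for the calls of `g`, `h` and `c`.
    (R := fun y => y.2.2.length * (3 * maxOn (fun z => R ⟨y.1, y.2.1, z⟩) y.2.2 + 3)) ?_ ?_).mono 3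
    fun x => ?_
  · refine (flatMap (X := Σ x, A x × List (S x)) (A := fun y => S y.1) (B := fun y => S y.1)
      (fun y => encS y.1) (fun y => encS y.1) (fun y => y.2.2)
      (fun y z => g y.1 z y.2.1 :: if c y.1 z y.2.1 then [h y.1 z y.2.1] else [])
      (T := fun _ => 0) (R := fun y => 3 * R ⟨y.1.1, y.1.2.1, y.2⟩)
      (fun y => 3 * maxOn (fun z => R ⟨y.1, y.2.1, z⟩) y.2.2 + 2)
      (refl.tl.hd.congr fun y => by simp [Val.hd, Val.tl]) ?_ fun y z hz => ?_).of_le fun y => ?_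
    · let e : (Σ y : (Σ x, A x × List (S x)), S y.1) → Σ x, A x × S x :=
        fun y => ⟨y.1.1, y.1.2.1, y.2⟩
      have henv : Runs (fun y : Σ y : (Σ x, A x × List (S x)), S y.1 =>
          .cons (encS y.1.1 y.2) (.cons (encA y.1.1 y.1.2.1)
            (.cons (encList (y.1.2.2.map (encS y.1.1))) (D y.1.1))))
          (fun y => .cons (encA (e y).1 (e y).2.1) (.cons (encS (e y).1 (e y).2.2) (D (e y).1)))
          (fun _ => 0) :=
        (refl.tl.hd.cons (refl.hd.cons refl.tl.tl.tl)).congr fun y => by simp [Val.hd, Val.tl, e]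
      refine (((hg.call e henv).cons ((hc.call e henv).ite
        (((hh.call e henv).cons (const .nil)).of_le fun y => le_rfl)
        ((const .nil).of_le fun y => Nat.zero_le _))).congr fun y => ?_).of_le fun y => ?_
      · by_cases hcy : c y.1.1 y.2 y.1.2.1 <;> simp [encList, e, hcy]
      · simp only [e]; omega
    · have := le_maxOn (fun z => R ⟨y.1, y.2.1, z⟩) hz
      simp only [List.length_cons] at this ⊢
      split <;> simp <;> omega
    · simp
  · intro x l₁ a l₂ hl
    exact Nat.mul_le_mul (hN x l₁ a l₂ hl)
      (by have := maxOn_le (hR x l₁ a l₂ hl); simp only at this ⊢; omega)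
  · have : (l x).length * (N x * (3 * T₁ x + 3) + 1) ≤
        (l x).length * (3 * ((N x + 1) * (T₁ x + 1))) := Nat.mul_le_mul_left _ (by nlinarith)
    nlinarith

/-- Comparison of the length of a list with a number. -/
theorem length_lt : Runs (fun y : List Val × ℕ => .cons (encList y.1) (encNat y.2))
    (fun y => encBool (decide (y.1.length < y.2))) fun y => y.1.length := by
  have := foldl (X := List Val × ℕ) (A := fun _ => Val) (S := fun _ => ℕ) (fun _ => id)
    (fun _ => encNat) (fun y => y.1) (fun y => y.2) (fun _ k _ => k - 1) (fun _ => 0)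
    (D := fun y => .cons (encList y.1) (encNat y.2))
    (refl.hd.congr fun y => by simp [Val.hd]) (refl.tl.congr fun y => by simp [Val.tl])
    (R := fun _ => 0)
    (refl.tl.hd.tl.congr fun y => by simp [Val.hd, Val.tl, ← tl_encNat]) (by simp)
  refine (bool_of_iff this fun y => ?_).of_le fun y => by simp
  -- One unit is removed from the number per list element; truncated subtraction leaves something
  -- exactly when the list is shorter.
  have key : ∀ (l : List Val) k, l.foldl (fun k _ => k - 1) k = k - l.length := by
    intro l
    induction l with
    | nil => simp
    | cons a l ih => intro k; simp [ih]; omega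
  rw [encNat_eq_nil, key]
  simp
  omega

/-- Multiplication of numbers. -/
theorem mul : Runs (fun y : ℕ × ℕ => .cons (encNat y.1) (encNat y.2))
    (fun y => encNat (y.1 * y.2)) fun y => y.1 * (y.2 + 1) := by
  refine ((flatMap (X := ℕ × ℕ) (A := fun _ => Unit) (B := fun _ => Unit) (fun _ _ => .nil)
    (fun _ _ => .nil) (fun y => List.replicate y.1 ()) (fun y _ => List.replicate y.2 ())
    (D := fun y => .cons (encNat y.1) (encNat y.2)) (fun y => y.2)
    (refl.hd.congr fun y => by simp [Val.hd, encNat])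
    (refl.tl.tl.congr fun y => by simp [Val.tl, encNat]) (R := fun _ => 0) ?_).congr ?_).of_le ?_
  · simp
  · intro y
    rw [encNat_eq]
    congr 2
    exact List.ext_getElem (by simp) (by simp)
  · simp

end Runs

end WhileLang

namespace WhileLang

/-! ### Reachable states of a branching search -/

section Branch

variable {A S : Type*} {g h : S → A → S} {c : S → A → Bool}

theorem mem_branch {Z : List S} {a : A} {y : S} :
    y ∈ branch g h c Z a ↔ ∃ z ∈ Z, y = g z a ∨ c z a = true ∧ y = h z a := by
  simp only [branch, List.mem_flatMap, List.mem_cons]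
  refine exists_congr fun z => and_congr_right fun _ => or_congr_right ?_
  split <;> simp_all

theorem mem_foldl_branch {l : List A} {Z : List S} {y : S} :
    y ∈ l.foldl (branch g h c) Z ↔ ∃ z ∈ Z, y ∈ l.foldl (branch g h c) [z] := by
  induction l generalizing Z with
  | nil => simp
  | cons a l ih =>
    simp only [List.foldl_cons]
    rw [ih]
    constructor
    · rintro ⟨z', hz', hy⟩
      obtain ⟨z, hz, hz''⟩ := mem_branch.1 hz'
      exact ⟨z, hz, ih.2 ⟨z', mem_branch.2 ⟨z, by simp, hz''⟩, hy⟩⟩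
    · rintro ⟨z, hz, hy⟩
      obtain ⟨z', hz', hy'⟩ := ih.1 hy
      obtain ⟨z₁, hz₁, hz₁'⟩ := mem_branch.1 hz'
      rw [List.mem_singleton] at hz₁
      subst hz₁
      exact ⟨z', mem_branch.2 ⟨z₁, hz, hz₁'⟩, hy'⟩

theorem mem_foldl_branch_cons {a : A} {l : List A} {z y : S} :
    y ∈ (a :: l).foldl (branch g h c) [z] ↔ y ∈ l.foldl (branch g h c) [g z a] ∨
      c z a = true ∧ y ∈ l.foldl (branch g h c) [h z a] := by
  rw [List.foldl_cons, mem_foldl_branch]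
  simp only [mem_branch, List.mem_singleton, exists_eq_left]
  constructor
  · rintro ⟨z', rfl | ⟨hc, rfl⟩, hy⟩
    · exact .inl hy
    · exact .inr ⟨hc, hy⟩
  · rintro (hy | ⟨hc, hy⟩)
    · exact ⟨_, .inl rfl, hy⟩
    · exact ⟨_, .inr ⟨hc, rfl⟩, hy⟩

theorem forall_mem_foldl_branch {P : S → Prop} {l : List A} {Z : List S} (hZ : ∀ z ∈ Z, P z)
    (hg : ∀ z a, P z → P (g z a)) (hh : ∀ z a, P z → c z a = true → P (h z a)) :
    ∀ z ∈ l.foldl (branch g h c) Z, P z := by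
  induction l generalizing Z with
  | nil => simpa using hZ
  | cons a l ih =>
    refine ih fun y hy => ?_
    obtain ⟨z, hz, rfl | ⟨hc, rfl⟩⟩ := mem_branch.1 hy
    · exact hg z a (hZ z hz)
    · exact hh z a (hZ z hz) hc

end Branch

end WhileLang

namespace SetPacking

open WhileLang

/-! ### The kernel -/

/-! ### The degree test: branching over all subsets of one set -/

section Sparse

/-- Pass to the next element of the universe, without selecting the current one. -/
def skipElem (z : List (List Bool) × List ℕ) (_ : Bool) : List (List Bool) × List ℕ :=
  (z.1.flatMap fun v => [v.tail], z.2)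

/-- Pass to the next element of the universe, selecting the current one: the sets that do not contain
it are removed and the next threshold applies. -/
def selectElem (z : List (List Bool) × List ℕ) (_ : Bool) : List (List Bool) × List ℕ :=
  (z.1.flatMap fun v => if v.headD false then [v.tail] else [], z.2.tail)

/-- For each subset of the set with characteristic vector `s`, the members of `F` that contain it
(without the part of their characteristic vectors that has been read), and the remaining
thresholds. -/
def subsetStates (s : List Bool) (F : List (List Bool)) (t : List ℕ) :
    List (List (List Bool) × List ℕ) :=
  s.foldl (branch skipElem selectElem fun _ b => b) [(F, t)]

/-- For all subsets `c` of `s`, the number of members of `F` that contain `c` is below the threshold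
number `|c|`. -/
def sparse (s : List Bool) (F : List (List Bool)) (t : List ℕ) : Bool :=
  (subsetStates s F t).all fun z => decide (z.1.length < z.2.headD 0)

/-- Only a bit `true` creates a second successor, so a set of size at most `r` yields at most `2 ^
r` states, independently of the size of the universe. -/
theorem length_foldl_branch_le (l : List Bool) (Z : List (List (List Bool) × List ℕ)) :
    (l.foldl (branch skipElem selectElem fun _ b => b) Z).length ≤ Z.length * 2 ^ l.count true := by
  induction l generalizing Z with
  | nil => simp
  | cons b l ih =>
    refine (ih _).trans ?_
    cases b with
    | false => simp [branch]
    | true => simp [branch, pow_succ]; ring_nf; rfl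

theorem length_fst_le_of_mem {l : List Bool} {F : List (List Bool)} {t : List ℕ}
    {z : List (List Bool) × List ℕ} (hz : z ∈ subsetStates l F t) : z.1.length ≤ F.length := by
  refine forall_mem_foldl_branch (P := fun z => z.1.length ≤ F.length) (by simp) ?_ ?_ z hz
  · intro z a h
    simpa [skipElem] using h
  · intro z a h _
    refine le_trans ?_ h
    simp only [selectElem]
    induction z.1 with
    | nil => simp
    | cons v l ih =>
      simp only [List.flatMap_cons, List.length_append, List.length_cons]
      split <;> simp only [List.length_cons, List.length_nil] <;> omega

/-- Induction on the universe, splitting the sets `c` by whether they contain its first element `u`.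
Those containing `u` are counted by discarding the members of `F` without `u` and dropping one
threshold. The default threshold `0` makes the test fail on both sides once the list of thresholds
is exhausted. -/
theorem sparse_iff_aux {U : Type*} [DecidableEq U] (us : List U) (hus : us.Nodup) (s : Finset U)
    (F : List (Finset U)) (t : List ℕ) :
    (∀ z ∈ subsetStates (us.map fun u => decide (u ∈ s)) (F.map fun f => us.map fun u =>
      decide (u ∈ f)) t, z.1.length < z.2.headD 0) ↔
    ∀ c ⊆ s, (∀ u ∈ c, u ∈ us) → (F.filter fun f => c ⊆ f).length < t.getD c.card 0 := by
  induction us generalizing F t with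
  | nil =>
    simp only [subsetStates, List.map_nil, List.foldl_nil, List.mem_singleton, forall_eq]
    constructor
    · intro h c _ hc
      have : c = ∅ := Finset.eq_empty_of_forall_notMem fun u hu => by simpa using hc u hu
      subst this
      cases t with
      | nil => simp at h
      | cons => simpa using h
    · intro h
      have := h ∅ (by simp) (by simp)
      cases t with
      | nil => simp at this
      | cons => simpa using this
  | cons u us ih =>
    obtain ⟨hu, hus⟩ := List.nodup_cons.1 hus
    have e₀ : skipElem (F.map fun f => (u :: us).map fun u => decide (u ∈ f), t) (decide (u ∈ s)) =
        (F.map fun f => us.map fun u => decide (u ∈ f), t) := by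
      simp [skipElem, ← List.map_eq_flatMap]
    have e₁ : selectElem (F.map fun f => (u :: us).map fun u => decide (u ∈ f), t)
        (decide (u ∈ s)) = ((F.filter fun f => u ∈ f).map fun f => us.map fun u =>
          decide (u ∈ f), t.tail) := by
      simp only [selectElem, Prod.mk.injEq, and_true]
      clear ih e₀
      induction F with
      | nil => rfl
      | cons f F ih =>
        simp only [List.map_cons, List.flatMap_cons, List.headD_cons, List.tail_cons,
          List.filter_cons] at ih ⊢
        rw [ih]
        by_cases huf : u ∈ f <;> simp [huf]
    have key : (∀ z ∈ subsetStates ((u :: us).map fun u => decide (u ∈ s)) (F.map fun f =>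
        (u :: us).map fun u => decide (u ∈ f)) t, z.1.length < z.2.headD 0) ↔
        (∀ c ⊆ s, (∀ u ∈ c, u ∈ us) → (F.filter fun f => c ⊆ f).length < t.getD c.card 0) ∧
        (u ∈ s → ∀ c ⊆ s, (∀ u ∈ c, u ∈ us) →
          ((F.filter fun f => u ∈ f).filter fun f => c ⊆ f).length < t.tail.getD c.card 0) := by
      rw [← ih hus, ← ih hus, subsetStates]
      conv_lhs => rw [List.map_cons (l := us) (f := fun u => decide (u ∈ s))]
      simp only [mem_foldl_branch_cons, e₀, e₁, decide_eq_true_eq, or_imp, forall_and, subsetStates]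
      refine and_congr_right fun _ => ?_
      constructor
      · exact fun h hu z hz => h z ⟨hu, hz⟩
      · exact fun h z hz => h hz.1 z hz.2
    rw [key]
    have ht : ∀ j, t.tail.getD j 0 = t.getD (j + 1) 0 := by cases t <;> simp
    constructor
    · rintro ⟨h₀, h₁⟩ c hcs hc
      by_cases huc : u ∈ c
      · have := h₁ (hcs huc) (c.erase u) ((Finset.erase_subset _ _).trans hcs) fun v hv => by
          have := hc v (Finset.mem_of_mem_erase hv)
          simpa [Finset.ne_of_mem_erase hv] using this
        rw [ht, Finset.card_erase_add_one huc, List.filter_filter] at this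
        convert this using 4 with f
        rw [← Bool.decide_and, decide_eq_decide]
        constructor
        · exact fun h => ⟨(Finset.erase_subset _ _).trans h, h huc⟩
        · rintro ⟨h, hf⟩
          rw [← Finset.insert_erase huc]
          exact Finset.insert_subset hf h
      · exact h₀ c hcs fun v hv => by
          have := hc v hv
          rcases List.mem_cons.1 this with rfl | h
          · exact absurd hv huc
          · exact h
    · intro h
      refine ⟨fun c hcs hc => h c hcs fun v hv => by simp [hc v hv], fun hus' c hcs hc => ?_⟩
      have huc : u ∉ c := fun h => hu (hc u h)
      have := h (insert u c) (Finset.insert_subset hus' hcs) fun v hv => by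
        rcases Finset.mem_insert.1 hv with rfl | h
        · simp
        · simp [hc v h]
      rw [Finset.card_insert_of_notMem huc, ← ht] at this
      rw [List.filter_filter]
      convert this using 4 with f
      rw [← Bool.decide_and, decide_eq_decide, Finset.insert_subset_iff, and_comm]

/-- The characteristic vector of a set. -/
def charVec {n : ℕ} (s : Finset (Fin n)) : List Bool :=
  (List.finRange n).map fun u => decide (u ∈ s)

theorem sparse_iff {n : ℕ} (s : Finset (Fin n)) (F : List (Finset (Fin n))) (t : List ℕ) :
    sparse (charVec s) (F.map charVec) t = true ↔
      ∀ c ⊆ s, (F.filter fun f => c ⊆ f).length < t.getD c.card 0 := by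
  have := sparse_iff_aux (List.finRange n) (List.nodup_finRange n) s F t
  simp only [List.mem_finRange, implies_true, true_imp_iff] at this
  rw [← this]
  simp only [sparse, List.all_eq_true, decide_eq_true_eq]
  rfl

end Sparse

/-! ### Greedy selection from a list -/

section Greedy

variable {α : Type*} (keep : List α → α → Bool)

/-- Go through a list and collect the elements that are to be kept. -/
def greedy (L F : List α) : List α :=
  L.foldl (fun F s => if keep F s then s :: F else F) F

variable {keep}

theorem greedy_cons (s : α) (L F : List α) :
    greedy keep (s :: L) F = greedy keep L (if keep F s then s :: F else F) := rfl

theorem suffix_greedy (L F : List α) : F <:+ greedy keep L F := by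
  induction L generalizing F with
  | nil => exact List.suffix_rfl
  | cons s L ih =>
    rw [greedy_cons]
    refine List.IsSuffix.trans ?_ (ih _)
    split
    · exact List.suffix_cons s F
    · exact List.suffix_rfl

theorem greedy_sublist (L F : List α) : (greedy keep L F).Sublist (L.reverse ++ F) := by
  induction L generalizing F with
  | nil => simp [greedy]
  | cons s L ih =>
    rw [greedy_cons]
    refine (ih _).trans ?_
    simp only [List.reverse_cons, List.append_assoc, List.singleton_append]
    refine List.Sublist.append_left ?_ _
    split <;> simp

theorem exists_suffix_of_notMem_greedy {L F : List α} {s : α} (hs : s ∈ L)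
    (hs' : s ∉ greedy keep L F) : ∃ F', F' <:+ greedy keep L F ∧ keep F' s = false := by
  induction L generalizing F with
  | nil => simp at hs
  | cons a L ih =>
    rw [greedy_cons] at hs' ⊢
    rcases List.mem_cons.1 hs with rfl | hs
    · refine ⟨F, (suffix_greedy (s :: L) F), ?_⟩
      by_contra hk
      rw [Bool.not_eq_false] at hk
      rw [if_pos hk] at hs'
      exact hs' ((suffix_greedy L (s :: F)).subset (by simp))
    · exact ih hs hs'

theorem greedy_induction {P : List α → Prop} (hP : ∀ F s, P F → keep F s = true → P (s :: F))
    (L : List α) {F : List α} (hF : P F) : P (greedy keep L F) := by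
  induction L generalizing F with
  | nil => exact hF
  | cons a L ih =>
    rw [greedy_cons]
    refine ih ?_
    split
    · exact hP _ _ hF ‹_›
    · exact hF

end Greedy

/-- The thresholds `q ^ r, …, q, 1`. -/
def thresholds (q : ℕ) : ℕ → List ℕ
  | 0 => [1]
  | r + 1 => q ^ (r + 1) :: thresholds q r

theorem thresholds_getD (q r j : ℕ) (hj : j ≤ r) : (thresholds q r).getD j 0 = q ^ (r - j) := by
  induction r generalizing j with
  | zero =>
    obtain rfl : j = 0 := by omega
    simp [thresholds]
  | succ r ih =>
    cases j with
    | zero => simp [thresholds]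
    | succ j => simpa [thresholds] using ih j (by omega)

variable {n r : ℕ}

/-- A subcollection that contains, for every small set `c`, at most `q ^ (r - |c|)` supersets of
`c`. -/
def kernel (q : ℕ) (L : List (SmallSet n r)) : List (SmallSet n r) :=
  greedy (fun F s => sparse (charVec s.1) (F.map fun f => charVec f.1) (thresholds q r)) L []

theorem keep_iff (q : ℕ) (F : List (SmallSet n r)) (s : SmallSet n r) :
    sparse (charVec s.1) (F.map fun f => charVec f.1) (thresholds q r) = true ↔
      ∀ c ⊆ s.1, (F.filter fun f => c ⊆ f.1).length < q ^ (r - c.card) := by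
  have := sparse_iff s.1 (F.map (·.1)) (thresholds q r)
  rw [List.map_map] at this
  refine this.trans (forall₂_congr fun c hc => ?_)
  rw [thresholds_getD _ _ _ ((Finset.card_le_card hc).trans s.2), List.filter_map, List.length_map]
  rfl

theorem kernel_subset {q : ℕ} {L : List (SmallSet n r)} : kernel q L ⊆ L := fun s hs => by
  have := (greedy_sublist L []).subset hs
  simpa using this

theorem kernel_nodup {q : ℕ} {L : List (SmallSet n r)} (hL : L.Nodup) : (kernel q L).Nodup :=
  (greedy_sublist L []).nodup (by simpa using hL)

/-- An invariant of the greedy selection: the count for `c` grows only when a set containing `c` is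
added, and the test then guarantees that it was strictly below the bound. -/
theorem length_filter_kernel_le (q : ℕ) (L : List (SmallSet n r)) (c : Finset (Fin n)) :
    ((kernel q L).filter fun f => c ⊆ f.1).length ≤ q ^ (r - c.card) := by
  refine greedy_induction (P := fun F => (F.filter fun f => c ⊆ f.1).length ≤ q ^ (r - c.card))
    (fun F s hF hs => ?_) L (F := []) (Nat.zero_le _)
  rw [List.filter_cons]
  split_ifs with h
  · exact (keep_iff q F s).1 hs c (by simpa using h)
  · exact hF

theorem length_kernel_le (q : ℕ) (L : List (SmallSet n r)) : (kernel q L).length ≤ q ^ r := by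
  simpa using length_filter_kernel_le q L ∅

/-- At the moment of rejection the test failed for some `c`; the collection held then is a suffix of
the final one, so the count for `c` can only have grown since. -/
theorem exists_of_notMem_kernel {q : ℕ} {L : List (SmallSet n r)} {s : SmallSet n r} (hs : s ∈ L)
    (hs' : s ∉ kernel q L) :
    ∃ c ⊆ s.1, q ^ (r - c.card) ≤ ((kernel q L).filter fun f => c ⊆ f.1).length := by
  obtain ⟨F, hF, hk⟩ := exists_suffix_of_notMem_greedy hs hs'
  have := mt (keep_iff q F s).2 (by rw [hk]; exact Bool.false_ne_true)
  push Not at this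
  obtain ⟨c, hc, h⟩ := this
  exact ⟨c, hc, h.trans (hF.sublist.filter _).length_le⟩

/-- A packing of `k` members of `L` can be exchanged for one in the kernel. -/
theorem exists_packing_kernel {cf : SmallSet n r → SmallSet n r → Prop}
    (symm : ∀ s t, cf s t → cf t s)
    (hcf : ∀ s w t c, ¬ cf w s → c ⊆ s.1 → c ⊆ t.1 → cf w t → ∃ u ∈ w.1, u ∈ t.1 ∧ u ∉ c)
    {k : ℕ} (hr : 1 ≤ r) {L : List (SmallSet n r)} (hL : L.Nodup) (P : Finset (SmallSet n r))
    (hPL : ∀ s ∈ P, s ∈ L) (hk : P.card = k) (hP : ∀ s ∈ P, ∀ t ∈ P, s ≠ t → ¬ cf s t) :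
    ∃ P' : Finset (SmallSet n r), (∀ s ∈ P', s ∈ kernel ((r + 1) * k) L) ∧ P'.card = k ∧
      ∀ s ∈ P', ∀ t ∈ P', s ≠ t → ¬ cf s t := by
  classical
  set q := (r + 1) * k with hq
  set K := (kernel q L).toFinset with hK
  have hdeg : ∀ c : Finset (Fin n), (K.filter fun f => c ⊆ f.1).card =
      ((kernel q L).filter fun f => c ⊆ f.1).length := fun c => by
    rw [← List.toFinset_card_of_nodup ((kernel_nodup hL).filter _), List.toFinset_filter]
    simp [hK]
  -- Each exchange lowers the number of members of the packing outside the kernel.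
  induction hm : (P \ K).card using Nat.strong_induction_on generalizing P with
  | _ m ih =>
    by_cases hPK : P ⊆ K
    · exact ⟨P, fun s hs => by simpa [hK] using hPK hs, hk, hP⟩
    obtain ⟨s, hsP, hsK⟩ := Finset.not_subset.1 hPK
    obtain ⟨c, hcs, hc⟩ := exists_of_notMem_kernel (q := q) (hPL s hsP) (by simpa [hK] using hsK)
    rw [← hdeg] at hc
    have hk1 : 1 ≤ k := by rw [← hk]; exact Finset.card_pos.2 ⟨s, hsP⟩
    have hq1 : 1 ≤ q := Nat.mul_pos (by omega) hk1
    have hcr : c.card ≤ r := (Finset.card_le_card hcs).trans s.2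
    -- If `|c| = r`, then `c` is its only superset of size at most `r`, so the kept superset of `c`
    -- would be `s` itself.
    have hcr' : c.card < r := by
      refine lt_of_le_of_ne hcr fun h => hsK ?_
      have hpos : 0 < (K.filter fun f => c ⊆ f.1).card := lt_of_lt_of_le (by positivity) hc
      obtain ⟨t, ht⟩ := Finset.card_pos.1 hpos
      rw [Finset.mem_filter] at ht
      have h₁ : c = s.1 := Finset.eq_of_subset_of_card_le hcs (by rw [h]; exact s.2)
      have h₂ : c = t.1 := Finset.eq_of_subset_of_card_le ht.2 (by rw [h]; exact t.2)
      have : s = t := Subtype.ext (h₁.symm.trans h₂)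
      exact this ▸ ht.1
    obtain ⟨j, hj⟩ : ∃ j, r - c.card = j + 1 := ⟨r - c.card - 1, by omega⟩
    -- The kernel members that share an element outside `c` with another member of the packing, and
    -- `c` itself, which might already belong to the packing.
    let bad : Finset (SmallSet n r) := ({⟨c, hcr⟩} : Finset (SmallSet n r)) ∪
      (P.erase s).biUnion fun w => (w.1 \ c).biUnion fun u => K.filter fun f => insert u c ⊆ f.1
    have hbad : bad.card < q ^ (j + 1) := by
      -- Each of the `k - 1` other members has at most `r` elements `u` outside `c`, and `insert u
      -- c` has at most `q ^ j` supersets in the kernel. The factor `r + 1` in `q`, instead of `r`,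
      -- leaves room for the extra bad set `c`, even when `r = 1`.
      have h₁ : bad.card ≤ 1 + (k - 1) * (r * q ^ j) := by
        refine (Finset.card_union_le _ _).trans (Nat.add_le_add (by simp) ?_)
        rw [← hk, ← Finset.card_erase_of_mem hsP]
        refine Finset.card_biUnion_le_card_mul _ _ _ fun w _ => ?_
        refine (Finset.card_biUnion_le_card_mul _ _ (q ^ j) fun u hu => ?_).trans
          (Nat.mul_le_mul_right _ ((Finset.card_le_card Finset.sdiff_subset).trans w.2))
        rw [hdeg]
        refine (length_filter_kernel_le q L _).trans (le_of_eq ?_)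
        rw [Finset.card_insert_of_notMem (Finset.mem_sdiff.1 hu).2]
        congr 1
        omega
      refine lt_of_le_of_lt h₁ ?_
      obtain ⟨k', rfl⟩ : ∃ k', k = k' + 1 := ⟨k - 1, by omega⟩
      have hqj : 1 ≤ q ^ j := Nat.one_le_pow _ _ hq1
      have e : q ^ (j + 1) = q ^ j * ((r + 1) * (k' + 1)) := by rw [pow_succ, ← hq]
      rw [e, add_tsub_cancel_right]
      nlinarith [Nat.zero_le (q ^ j * k'), Nat.zero_le (q ^ j * k' * r)]
    have : ∃ t ∈ K.filter fun f => c ⊆ f.1, t ∉ bad := by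
      by_contra! h
      have := Finset.card_le_card (show K.filter (fun f => c ⊆ f.1) ⊆ bad from h)
      rw [hj] at hc
      omega
    obtain ⟨t, ht, htb⟩ := this
    rw [Finset.mem_filter] at ht
    have hmeet : ∀ w ∈ P.erase s, ∀ u ∈ w.1, u ∈ t.1 → u ∈ c := by
      intro w hw u hu hut
      by_contra huc
      refine htb (Finset.mem_union_right _ (Finset.mem_biUnion.2 ⟨w, hw, Finset.mem_biUnion.2
        ⟨u, Finset.mem_sdiff.2 ⟨hu, huc⟩, Finset.mem_filter.2 ⟨ht.1, ?_⟩⟩⟩))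
      exact Finset.insert_subset hut ht.2
    have htc : t.1 ≠ c := fun h => htb (Finset.mem_union_left _ (by simp [Subtype.ext_iff, h]))
    -- Were `t` one of the other members, it would meet itself only inside `c`, forcing `t = c`.
    -- Hence the exchange does not shrink the packing.
    have htP : t ∉ P.erase s := by
      intro h
      exact htc (Finset.Subset.antisymm (fun u hu => hmeet t h u hu hu) ht.2)
    have hok : ∀ w ∈ P.erase s, ¬ cf w t := by
      intro w hw hwt
      obtain ⟨u, h₁, h₂, h₃⟩ := hcf s w t c
        (hP w (Finset.mem_of_mem_erase hw) s hsP (Finset.ne_of_mem_erase hw)) hcs ht.2 hwt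
      exact h₃ (hmeet w hw u h₁ h₂)
    refine ih ((insert t (P.erase s)) \ K).card ?_ (insert t (P.erase s)) ?_ ?_ ?_ rfl
    · rw [← hm]
      refine Finset.card_lt_card ⟨?_, fun h => ?_⟩
      · intro w hw
        rw [Finset.mem_sdiff, Finset.mem_insert] at hw
        rcases hw with ⟨rfl | hw, hwK⟩
        · exact absurd ht.1 hwK
        · exact Finset.mem_sdiff.2 ⟨Finset.mem_of_mem_erase hw, hwK⟩
      · have := h (Finset.mem_sdiff.2 ⟨hsP, hsK⟩)
        rw [Finset.mem_sdiff, Finset.mem_insert] at this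
        rcases this.1 with rfl | h
        · exact hsK ht.1
        · simp at h
    · intro w hw
      rcases Finset.mem_insert.1 hw with rfl | hw
      · exact kernel_subset (q := q) (by simpa [hK] using ht.1)
      · exact hPL w (Finset.mem_of_mem_erase hw)
    · rw [Finset.card_insert_of_notMem htP, Finset.card_erase_of_mem hsP]
      omega
    · intro a ha b hb hab
      rcases Finset.mem_insert.1 ha with ha | ha <;> rcases Finset.mem_insert.1 hb with hb | hb
      · exact absurd (ha.trans hb.symm) hab
      · exact fun h => hok b hb (symm _ _ (ha ▸ h))
      · exact fun h => hok a ha (hb ▸ h)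
      · exact hP a (Finset.mem_of_mem_erase ha) b (Finset.mem_of_mem_erase hb) hab

/-! ### The search -/

section Search

variable {E : Type*} (ok : E → E → Bool)

/-- Add an element to a partial packing, which then needs one element less. -/
def extend (z : List E × ℕ) (s : E) : List E × ℕ := (s :: z.1, z.2 - 1)

/-- An element may be added to a partial packing. -/
def extendable (z : List E × ℕ) (s : E) : Bool := decide (z.2 ≠ 0) && z.1.all (ok s)

/-- All packings of at most `k` members of `F`, with the number of missing elements. -/
def partialPackings (k : ℕ) (F : List E) : List (List E × ℕ) :=
  F.foldl (branch (fun z _ => z) extend (extendable ok)) [([], k)]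

variable {ok}

/-- Each new element is compared with the elements already chosen in one order only, which suffices
by symmetry. The statement allows an arbitrary partial packing `p` so that the induction on `F` goes
through. -/
theorem exists_mem_foldl_branch_iff (symm : ∀ s t, ok s t = ok t s) (F : List E) (p : List E)
    (k : ℕ) :
    (∃ z ∈ F.foldl (branch (fun z _ => z) extend (extendable ok)) [(p, k)], z.2 = 0) ↔
      ∃ q : List E, q.Sublist F ∧ q.length = k ∧ q.Pairwise (fun s t => ok s t = true) ∧
        ∀ a ∈ q, ∀ b ∈ p, ok a b = true := by
  induction F generalizing p k with
  | nil =>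
    simp only [List.foldl_nil, List.mem_singleton, exists_eq_left, List.sublist_nil]
    constructor
    · rintro rfl; simp
    · rintro h; simpa using h.1.symm
  | cons s F ih =>
    simp only [mem_foldl_branch_cons, or_and_right, exists_or]
    rw [ih]
    simp only [and_assoc, exists_and_left, extend]
    rw [ih]
    constructor
    · rintro (⟨q, h₁, h₂⟩ | ⟨hs, q, h₁, h₂, h₃, h₄⟩)
      · exact ⟨q, h₁.cons s, h₂⟩
      · simp only [extendable, Bool.and_eq_true, decide_eq_true_eq, List.all_eq_true] at hs
        refine ⟨s :: q, h₁.cons_cons s, by simp; omega, ?_, ?_⟩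
        · refine List.pairwise_cons.2 ⟨fun a ha => ?_, h₃⟩
          rw [symm]
          exact h₄ a ha s (by simp)
        · intro a ha b hb
          rcases List.mem_cons.1 ha with rfl | ha
          · exact hs.2 b hb
          · exact h₄ a ha b (by simp [hb])
    · rintro ⟨q, h₁, h₂, h₃, h₄⟩
      cases h₁ with
      | cons _ h₁ => exact .inl ⟨q, h₁, h₂, h₃, h₄⟩
      | @cons_cons q _ _ h₁ =>
        rw [List.pairwise_cons] at h₃
        simp only [List.length_cons] at h₂
        refine .inr ⟨?_, q, h₁, by omega, h₃.2, fun a ha b hb => ?_⟩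
        · simp only [extendable, Bool.and_eq_true, decide_eq_true_eq, List.all_eq_true]
          exact ⟨by omega, fun b hb => h₄ s (by simp) b hb⟩
        · rcases List.mem_cons.1 hb with rfl | hb
          · rw [symm]
            exact h₃.1 a ha
          · exact h₄ a (by simp [ha]) b hb

/-- A potential argument: a state that still needs `j` elements has weight `(f + 1) ^ j`, where `f`
is the number of elements not yet read. Reading one does not increase the total weight, because `(f
+ 1) ^ (j + 1) + (f + 1) ^ j ≤ (f + 2) ^ (j + 1)`, and at the end every state weighs `1`. -/
theorem length_partialPackings_le (k : ℕ) (F : List E) :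
    (partialPackings ok k F).length ≤ (F.length + 1) ^ k := by
  have key : ∀ Z : List (List E × ℕ),
      (F.foldl (branch (fun z _ => z) extend (extendable ok)) Z).length ≤
        (Z.map fun z => (F.length + 1) ^ z.2).sum := by
    induction F with
    | nil => intro Z; simp
    | cons s F ih =>
      intro Z
      refine (ih _).trans ?_
      induction Z with
      | nil => simp [branch]
      | cons z Z ihZ =>
        have : branch (fun z _ => z) extend (extendable ok) (z :: Z) s =
          (z :: if extendable ok z s then [extend z s] else []) ++
            branch (fun z _ => z) extend (extendable ok) Z s := rfl
        rw [this, List.map_append, List.sum_append, List.map_cons (l := Z), List.sum_cons]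
        refine Nat.add_le_add ?_ ihZ
        split_ifs with h
        · simp only [extendable, Bool.and_eq_true, decide_eq_true_eq] at h
          obtain ⟨j, hj⟩ := Nat.exists_eq_succ_of_ne_zero h.1
          simp only [extend, hj, List.map_cons, List.map_nil, List.sum_cons, List.sum_nil,
            List.length_cons, Nat.succ_eq_add_one, add_tsub_cancel_right, pow_succ, add_zero]
          have : (F.length + 1) ^ j ≤ (F.length + 1 + 1) ^ j := Nat.pow_le_pow_left (by omega) j
          nlinarith
        · simpa using Nat.pow_le_pow_left (Nat.le_succ (F.length + 1)) z.2
  simpa [partialPackings] using key [([], k)]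

theorem length_le_of_mem_partialPackings {k : ℕ} {F : List E} {z : List E × ℕ}
    (hz : z ∈ partialPackings ok k F) : z.1.length ≤ k := by
  -- Extension requires a nonzero number of missing elements, so the truncated subtraction in
  -- `extend` is a true one and the sum stays `k`.
  have := forall_mem_foldl_branch (P := fun z : List E × ℕ => z.1.length + z.2 = k) (by simp)
    (fun z a h => h) (fun z a h hc => ?_) z hz
  · omega
  · simp only [extendable, Bool.and_eq_true, decide_eq_true_eq] at hc
    simp only [extend, List.length_cons]
    omega

end Search

end SetPacking

namespace SetPacking

open WhileLang

/-! ### The programs -/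

/-- A vector of Booleans as a tree. -/
def encVec (v : List Bool) : Val := encList (v.map encBool)

theorem encSet_eq {n : ℕ} (s : Finset (Fin n)) : encSet s = encVec (charVec s) := by
  simp [encSet, encVec, charVec, Function.comp_def]

/-- A list of vectors and a list of numbers as a tree. -/
def encSubsetState (z : List (List Bool) × List ℕ) : Val :=
  .cons (encList (z.1.map encVec)) (encList (z.2.map encNat))

theorem hd_encVec (v : List Bool) : (encVec v).hd = encBool (v.headD false) :=
  hd_encList_map _ _ _ rfl

theorem tl_encVec (v : List Bool) : (encVec v).tl = encVec v.tail := tl_encList_map _ _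

theorem runs_tails : Runs (fun F : List (List Bool) => encList (F.map encVec))
    (fun F => encList ((F.flatMap fun v => [v.tail]).map encVec)) fun F => F.length :=
  (Runs.flatMap (X := List (List Bool)) (A := fun _ => List Bool) (B := fun _ => List Bool)
    (fun _ => encVec) (fun _ => encVec) (fun F => F) (fun _ v => [v.tail])
    (D := fun F => encList (F.map encVec)) (fun _ => 1) Runs.refl (R := fun _ => 0)
    ((Runs.refl.hd.tl.cons (Runs.const .nil)).congr fun y => by simp [tl_encVec, encList])
    (by simp)).mono 2 fun F => by omega

theorem runs_selectTails : Runs (fun F : List (List Bool) => encList (F.map encVec))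
    (fun F => encList ((F.flatMap fun v => if v.headD false then [v.tail] else []).map encVec))
    fun F => F.length :=
  (Runs.flatMap (X := List (List Bool)) (A := fun _ => List Bool) (B := fun _ => List Bool)
    (fun _ => encVec) (fun _ => encVec) (fun F => F)
    (fun _ v => if v.headD false then [v.tail] else [])
    (D := fun F => encList (F.map encVec)) (fun _ => 1) Runs.refl (R := fun _ => 0)
    (((Runs.refl.hd.hd.congr fun y => by simp only [Val.hd_cons]; exact hd_encVec y.2).ite
      (Runs.refl.hd.tl.cons (Runs.const .nil)) (Runs.const .nil)).congr fun y => by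
        split <;> simp [tl_encVec, encList])
    (fun F v _ => by split <;> simp)).mono 2 fun F => by omega

theorem runs_skipElem : Runs encSubsetState (fun z => encSubsetState (skipElem z false))
    fun z => z.1.length :=
  (((runs_tails.call (fun z : List (List Bool) × List ℕ => z.1) Runs.refl.hd).cons
    Runs.refl.tl).congr fun z => by simp [encSubsetState, skipElem]).of_le fun z => by simp

theorem runs_selectElem : Runs encSubsetState (fun z => encSubsetState (selectElem z false))
    fun z => z.1.length :=
  (((runs_selectTails.call (fun z : List (List Bool) × List ℕ => z.1) Runs.refl.hd).cons
    Runs.refl.tl.tl).congr fun z => by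
      simp [encSubsetState, selectElem]).of_le fun z => by simp

theorem runs_sparse : Runs (fun y : List Bool × List (List Bool) × List ℕ =>
      .cons (encVec y.1) (encSubsetState y.2)) (fun y => encBool (sparse y.1 y.2.1 y.2.2))
    fun y => (y.1.length + 1) * 2 ^ y.1.count true * (y.2.1.length + 1) := by
  have h₁ := Runs.foldl_branch (X := List Bool × List (List Bool) × List ℕ) (A := fun _ => Bool)
    (S := fun _ => List (List Bool) × List ℕ) (fun _ => encBool) (fun _ => encSubsetState)
    (D := fun y => .cons (encVec y.1) (encSubsetState y.2)) (fun y => y.1) (fun y => [y.2])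
    (fun _ => skipElem) (fun _ => selectElem) (fun _ _ b => b)
    (fun y => 2 ^ y.1.count true) (fun y => y.2.1.length) (R := fun y => y.2.2.1.length)
    Runs.refl.hd ((Runs.refl.tl.cons (Runs.const .nil)).congr fun y => by simp [encList])
    ((runs_skipElem.call (fun y : Σ _ : List Bool × List (List Bool) × List ℕ,
      Bool × (List (List Bool) × List ℕ) => y.2.2) Runs.refl.tl.hd).of_le fun y => by simp)
    ((runs_selectElem.call (fun y : Σ _ : List Bool × List (List Bool) × List ℕ,
      Bool × (List (List Bool) × List ℕ) => y.2.2) Runs.refl.tl.hd).of_le fun y => by simp)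
    (Runs.refl.hd.of_le fun y => Nat.zero_le _)
    (fun y l₁ a l₂ h => by
      refine (length_foldl_branch_le l₁ _).trans ?_
      rw [List.length_singleton, one_mul, h, List.count_append]
      exact Nat.pow_le_pow_right (by omega) (by omega))
    (fun y l₁ a l₂ h z hz => length_fst_le_of_mem hz)
  have h₂ := Runs.all (A := fun _ => List (List Bool) × List ℕ) (fun _ => encSubsetState)
    (fun y : List Bool × List (List Bool) × List ℕ => subsetStates y.1 y.2.1 y.2.2)
    (fun _ z => decide (z.1.length < z.2.headD 0)) (fun y => y.2.1.length)
    (R := fun y => y.2.1.length) h₁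
    (((Runs.length_lt.call (fun y : Σ _ : List Bool × List (List Bool) × List ℕ,
        List (List Bool) × List ℕ => (y.2.1.map encVec, y.2.2.headD 0))
      (T := fun _ => 0) ((Runs.refl.hd.hd.cons Runs.refl.hd.tl.hd).congr fun y => by
        simp only [Val.hd_cons, Val.tl_cons, encSubsetState]
        rw [hd_encList_map _ _ 0 rfl])).congr fun y => by simp).of_le fun y => by simp)
    (fun y z hz => length_fst_le_of_mem hz)
  refine (h₂.congr fun y => rfl).mono 4 fun y => ?_
  have h := length_foldl_branch_le y.1 [y.2]
  rw [List.length_singleton, one_mul] at h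
  have h' : (subsetStates y.1 y.2.1 y.2.2).length ≤ 2 ^ y.1.count true := h
  have hN : 1 ≤ 2 ^ y.1.count true := Nat.one_le_two_pow
  generalize 2 ^ y.1.count true = N at *
  generalize y.1.length = a
  generalize y.2.1.length + 1 = b
  have h'' := Nat.mul_le_mul_right b h'
  have : a * ((N + 1) * b) ≤ a * ((2 * N) * b) :=
    Nat.mul_le_mul_left _ (Nat.mul_le_mul_right _ (by omega))
  nlinarith [Nat.zero_le (a * N * b), Nat.zero_le (N * b)]

theorem foldl_thresholds (q : ℕ) (l : List Unit) :
    l.foldl (fun Z _ => Z.headD 0 * q :: Z) [1] = thresholds q l.length := by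
  have hhead : ∀ r, (thresholds q r).headD 0 = q ^ r := by
    intro r; cases r <;> simp [thresholds]
  induction l using List.reverseRecOn with
  | nil => rfl
  | append_singleton l a ih =>
    rw [List.foldl_append, ih, List.length_append]
    simp only [List.foldl_cons, List.foldl_nil, hhead, List.length_singleton, thresholds, pow_succ]

/-- The table is built from its last entry `1`, prepending the head times `q`. It takes `r` unary
multiplications, a constant number. -/
theorem runs_thresholds (r : ℕ) : Runs encNat
    (fun k => encList ((thresholds ((r + 1) * k) r).map encNat)) fun k => (k + 1) ^ (r + 1) := by
  have h₁ := Runs.foldl (X := ℕ) (A := fun _ => Unit) (S := fun _ => List ℕ) (fun _ _ => .nil)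
    (fun _ Z => encList (Z.map encNat)) (D := encNat) (fun _ => List.replicate r ())
    (fun _ => [1]) (fun q Z _ => Z.headD 0 * q :: Z) (fun q => (q + 1) ^ (r + 1))
    (Runs.const _) (Runs.const (encList ([1].map encNat)))
    (R := fun y => y.2.2.headD 0 * (y.1 + 1))
    (((Runs.mul.call (fun y : Σ _ : ℕ, Unit × List ℕ => (y.2.2.headD 0, y.1))
      (T := fun _ => 0) ((Runs.refl.tl.hd.hd.cons Runs.refl.tl.tl).congr fun y => by
        simp only [Val.hd_cons, Val.tl_cons]
        rw [hd_encList_map _ _ 0 rfl])).cons Runs.refl.tl.hd).congr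
        (fun y => by simp [encList]) |>.of_le fun y => by simp)
    (fun q l₁ a l₂ h => by
      have hl : l₁.length < r := by
        have := congrArg List.length h
        simp at this
        omega
      have hhead : (thresholds q l₁.length).headD 0 = q ^ l₁.length := by
        cases l₁.length <;> simp [thresholds]
      rw [foldl_thresholds, hhead, pow_succ]
      refine Nat.mul_le_mul_right _ ?_
      exact (Nat.pow_le_pow_left (by omega) _).trans (Nat.pow_le_pow_right (by omega) hl.le))
  have h₂ := Runs.mul.call (fun k => (r + 1, k)) (D := encNat)
    ((Runs.const (encNat (r + 1))).cons Runs.refl)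
  refine ((h₁.call (fun k => (r + 1) * k) h₂).congr fun k => ?_).mono
    ((r + 1) + r * (r + 2) ^ (r + 1) + r) fun k => ?_
  · rw [foldl_thresholds, List.length_replicate]
  · have e₁ : ((r + 1) * k + 1) ^ (r + 1) ≤ (r + 2) ^ (r + 1) * (k + 1) ^ (r + 1) := by
      rw [← mul_pow]
      exact Nat.pow_le_pow_left (by nlinarith) _
    have e₂ : k + 1 ≤ (k + 1) ^ (r + 1) := Nat.le_self_pow (by omega) _
    simp only [List.length_replicate]
    have e₃ := Nat.mul_le_mul_left r e₁
    have e₄ := Nat.mul_le_mul_left (r + 1) e₂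
    generalize ((r + 1) * k + 1) ^ (r + 1) = x at *
    generalize (k + 1) ^ (r + 1) = z at *
    generalize (r + 2) ^ (r + 1) = w at *
    nlinarith [Nat.zero_le (r * z), Nat.zero_le (r * w)]

theorem count_charVec {n : ℕ} (s : Finset (Fin n)) : (charVec s).count true = s.card := by
  rw [charVec, List.count_eq_countP, List.countP_map, List.countP_eq_length_filter,
    ← List.toFinset_card_of_nodup ((List.nodup_finRange n).filter _)]
  congr 1
  ext u
  simp

theorem length_greedy_le {α : Type*} {keep : List α → α → Bool} (L : List α) :
    (greedy keep L []).length ≤ L.length := by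
  simpa using (greedy_sublist (keep := keep) L []).length_le

theorem runs_kernel (r : ℕ) : Runs
    (fun y : Σ p : ℕ × ℕ, List (SmallSet p.1 r) => .cons (encList (y.2.map fun s => encSet s.1))
      (encList ((thresholds y.1.2 r).map encNat)))
    (fun y => encList ((kernel y.1.2 y.2).map fun s => encSet s.1))
    fun y => y.2.length * ((y.1.1 + 1) * (y.2.length + 1)) := by
  refine (Runs.foldl (A := fun y : Σ p : ℕ × ℕ, List (SmallSet p.1 r) => SmallSet y.1.1 r)
    (S := fun y => List (SmallSet y.1.1 r)) (fun _ s => encSet s.1)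
    (fun _ F => encList (F.map fun s => encSet s.1)) (fun y => y.2) (fun _ => [])
    (fun y F s => if sparse (charVec s.1) (F.map fun f => charVec f.1) (thresholds y.1.2 r) then
      s :: F else F)
    (fun y => 2 ^ r * ((y.1.1 + 1) * (y.2.length + 1))) Runs.refl.hd (Runs.const .nil)
    -- The factor `2 ^ r` counts the subsets of the tested set; as `r` is fixed, it goes into the
    -- constant.
    (R := fun y => (y.1.1.1 + 1) * 2 ^ r * (y.2.2.length + 1)) ?_ ?_).mono (2 ^ r + 1) fun y => ?_
  · have h := Runs.call runs_sparse (fun y : Σ y : (Σ p : ℕ × ℕ, List (SmallSet p.1 r)),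
      SmallSet y.1.1 r × List (SmallSet y.1.1 r) => (charVec y.2.1.1,
        y.2.2.map fun f => charVec f.1, thresholds y.1.1.2 r))
      (T := fun _ => 0)
      (D := fun y => .cons (encSet y.2.1.1) (.cons (encList (y.2.2.map fun s => encSet s.1))
        (.cons (encList (y.1.2.map fun s => encSet s.1))
          (encList ((thresholds y.1.1.2 r).map encNat)))))
      ((Runs.refl.hd.cons (Runs.refl.tl.hd.cons Runs.refl.tl.tl.tl)).congr fun y => by
        simp only [Val.hd_cons, Val.tl_cons, encSubsetState, encSet_eq, List.map_map]
        rfl)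
    refine ((h.ite (Runs.refl.hd.cons Runs.refl.tl.hd) Runs.refl.tl.hd).congr fun y => ?_).of_le
      fun y => ?_
    · dsimp only
      split <;> simp [encList]
    · simp only [List.length_map, charVec, List.length_finRange, zero_add, add_zero]
      refine Nat.mul_le_mul_right _ (Nat.mul_le_mul_left _ ?_)
      have := count_charVec y.2.1.1
      rw [charVec] at this
      rw [this]
      exact Nat.pow_le_pow_right (by omega) y.2.1.2
  · intro y l₁ a l₂ h
    have h₁ : l₁.length ≤ y.2.length := by rw [h]; simp
    have h₂ := length_greedy_le (keep := fun F s => sparse (charVec s.1)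
      (F.map fun f => charVec f.1) (thresholds y.1.2 r)) l₁
    have h₃ := Nat.mul_le_mul_left ((y.1.1 + 1) * 2 ^ r) (Nat.add_le_add_right (h₂.trans h₁) 1)
    refine h₃.trans (le_of_eq (by ring))
  · have : 1 ≤ (y.1.1 + 1) * (y.2.length + 1) := Nat.mul_pos (by omega) (by omega)
    have := Nat.mul_le_mul_left y.2.length this
    generalize (y.1.1 + 1) * (y.2.length + 1) = w at *
    nlinarith [Nat.zero_le (2 ^ r)]

variable {ι : Type*} {r : ℕ}

namespace OverlapConstraint

/-- The sets `s` and `t` do not conflict, in either order. -/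
def ok (A : OverlapConstraint ι r) (i : ι) (s t : SmallSet (A.size i) r) : Bool :=
  !A.α i s t && !A.α i t s

/-- The search finds `k` members of `F` without conflicts. -/
def found (A : OverlapConstraint ι r) (i : ι) (F : List (SmallSet (A.size i) r)) (k : ℕ) : Bool :=
  !(partialPackings (A.ok i) k F).all fun z => decide (z.2 ≠ 0)

/-- A partial packing as a tree. -/
def encPartial (A : OverlapConstraint ι r) (i : ι) (z : List (SmallSet (A.size i) r) × ℕ) : Val :=
  .cons (encList (z.1.map fun s => encSet s.1)) (encNat z.2)

variable {A : OverlapConstraint ι r} {d : ℕ}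

theorem runs_ok (hA : A.ComputableWithExponent d) :
    Runs (fun y : Σ i, SmallSet (A.size i) r × SmallSet (A.size i) r =>
      .cons (A.descr y.1) (.cons (encSet y.2.1.1) (encSet y.2.2.1)))
      (fun y => encBool (A.ok y.1 y.2.1 y.2.2)) fun y => A.size y.1 ^ d := by
  have h : Runs (fun y : Σ i, SmallSet (A.size i) r × SmallSet (A.size i) r =>
      .cons (A.descr y.1) (.cons (encSet y.2.1.1) (encSet y.2.2.1)))
      (fun y => encBool (A.α y.1 y.2.1 y.2.2)) fun y => A.size y.1 ^ d := by
    obtain ⟨p, B, hp⟩ := hA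
    refine ⟨p, B, fun y => ?_⟩
    obtain ⟨σ, t, h₁, h₂, h₃⟩ := hp y.1 y.2.1 y.2.2
    exact ⟨σ, t, h₁, h₂, h₃.trans (Nat.mul_le_mul_left _ (Nat.le_succ _))⟩
  have h' := h.call (fun y => ⟨y.1, y.2.2, y.2.1⟩) (T := fun _ => 0)
    (D := fun y : Σ i, SmallSet (A.size i) r × SmallSet (A.size i) r =>
      .cons (A.descr y.1) (.cons (encSet y.2.1.1) (encSet y.2.2.1)))
    ((Runs.refl.hd.cons (Runs.refl.tl.tl.cons Runs.refl.tl.hd)).congr fun y => rfl)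
  exact (h.not.and h'.not).mono 2 fun y => by simp only; omega

theorem runs_found (hA : A.ComputableWithExponent d) :
    Runs (fun x : Σ i, List (SmallSet (A.size i) r) × ℕ => A.encInstance x.1 x.2.1 x.2.2)
      (fun x => encBool (A.found x.1 x.2.1 x.2.2))
      fun x => (x.2.1.length + 1) * ((x.2.1.length + 1) ^ x.2.2 *
        (x.2.2 * (A.size x.1 ^ d + 1) + 1)) := by
  have hall : Runs (fun y : Σ x : (Σ i, List (SmallSet (A.size i) r) × ℕ), SmallSet (A.size x.1) r ×
      (List (SmallSet (A.size x.1) r) × ℕ) => .cons (encSet y.2.1.1)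
        (.cons (A.encPartial y.1.1 y.2.2) (A.encInstance y.1.1 y.1.2.1 y.1.2.2)))
      (fun y => encBool (y.2.2.1.all (A.ok y.1.1 y.2.1)))
      fun y => y.2.2.1.length * (A.size y.1.1 ^ d + 1) := by
    refine (Runs.all (A := fun y : Σ x : (Σ i, List (SmallSet (A.size i) r) × ℕ),
      SmallSet (A.size x.1) r × (List (SmallSet (A.size x.1) r) × ℕ) => SmallSet (A.size y.1.1) r)
      (fun _ s => encSet s.1) (fun y => y.2.2.1) (fun y s => A.ok y.1.1 y.2.1 s)
      (fun y => A.size y.1.1 ^ d) (T := fun _ => 0) Runs.refl.tl.hd.hd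
      (R := fun y => A.size y.1.1.1 ^ d) ?_ (fun y a _ => le_rfl)).of_le fun y => by simp
    exact ((runs_ok hA).call (fun y : Σ y : (Σ x : (Σ i, List (SmallSet (A.size i) r) × ℕ),
      SmallSet (A.size x.1) r × (List (SmallSet (A.size x.1) r) × ℕ)), SmallSet (A.size y.1.1) r =>
        ⟨y.1.1.1, y.1.2.1, y.2⟩)
      (T := fun _ => 0) ((Runs.refl.tl.tl.tl.hd.cons (Runs.refl.tl.hd.cons Runs.refl.hd)).congr
        fun y => rfl)).of_le fun y => by simp
  have hcond := (Runs.bool_of_iff (b := fun y : Σ x : (Σ i, List (SmallSet (A.size i) r) × ℕ),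
    SmallSet (A.size x.1) r × (List (SmallSet (A.size x.1) r) × ℕ) => decide (y.2.2.2 ≠ 0))
    (D := fun y => .cons (encSet y.2.1.1)
      (.cons (A.encPartial y.1.1 y.2.2) (A.encInstance y.1.1 y.1.2.1 y.1.2.2)))
    Runs.refl.tl.hd.tl fun y => by simp [encPartial, encNat_eq_nil]).and hall
  have h₁ := Runs.foldl_branch (X := Σ i, List (SmallSet (A.size i) r) × ℕ)
    (A := fun x => SmallSet (A.size x.1) r)
    (S := fun x => List (SmallSet (A.size x.1) r) × ℕ) (fun _ s => encSet s.1)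
    (fun x => A.encPartial x.1)
    (D := fun x => A.encInstance x.1 x.2.1 x.2.2) (fun x => x.2.1) (fun x => [([], x.2.2)])
    (fun _ z _ => z) (fun _ => extend) (fun x => extendable (A.ok x.1))
    (fun x => (x.2.1.length + 1) ^ x.2.2) (fun x => x.2.2 * (A.size x.1 ^ d + 1))
    (R := fun y => y.2.2.1.length * (A.size y.1.1 ^ d + 1))
    Runs.refl.tl.hd
    ((((Runs.const .nil).cons Runs.refl.tl.tl).cons (Runs.const .nil)).congr fun x => by
      simp [encList, encPartial, encInstance])
    (Runs.refl.tl.hd.of_le fun y => Nat.zero_le _)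
    ((((Runs.refl.hd.cons Runs.refl.tl.hd.hd).cons Runs.refl.tl.hd.tl.tl).congr fun y => by
      simp [encPartial, extend, encList, tl_encNat]).of_le fun y => Nat.zero_le _)
    (hcond.of_le fun y => by simp)
    (fun x l₁ a l₂ h => (length_partialPackings_le x.2.2 l₁).trans
      (Nat.pow_le_pow_left (by rw [h]; simp) _))
    (fun x l₁ a l₂ h z hz => Nat.mul_le_mul_right _ (length_le_of_mem_partialPackings hz))
  have h₂ := (Runs.all (A := fun x : Σ i, List (SmallSet (A.size i) r) × ℕ =>
      List (SmallSet (A.size x.1) r) × ℕ) (fun x => A.encPartial x.1)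
    (fun x => partialPackings (A.ok x.1) x.2.2 x.2.1)
    (fun _ z => decide (z.2 ≠ 0)) (fun y => 0)
    (R := fun y => 0) h₁
    (Runs.bool_of_iff Runs.refl.hd.tl fun y => by
      simp [encPartial, encNat_eq_nil]) (by simp)).not
  refine (h₂.congr fun x => rfl).mono 4 fun x => ?_
  have h := length_partialPackings_le (ok := A.ok x.1) x.2.2 x.2.1
  have hN : 1 ≤ (x.2.1.length + 1) ^ x.2.2 := Nat.one_le_pow _ _ (by omega)
  generalize (x.2.1.length + 1) ^ x.2.2 = N at *
  generalize x.2.1.length = a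
  generalize (partialPackings (A.ok x.1) x.2.2 x.2.1).length = P at *
  generalize x.2.2 * (A.size x.1 ^ d + 1) = b
  have : a * ((N + 1) * (b + 1)) ≤ a * ((2 * N) * (b + 1)) :=
    Nat.mul_le_mul_left _ (Nat.mul_le_mul_right _ (by omega))
  nlinarith [Nat.zero_le (a * N * b), Nat.zero_le (N * b), Nat.zero_le (a * N)]

/-- Kernelization followed by the search. -/
theorem runs_found_kernel (hA : A.ComputableWithExponent d) :
    Runs (fun x : Σ i, List (SmallSet (A.size i) r) × ℕ => A.encInstance x.1 x.2.1 x.2.2)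
      (fun x => encBool (A.found x.1 (kernel ((r + 1) * x.2.2) x.2.1) x.2.2))
      fun x => (x.2.2 + 1) ^ (r + 1) +
        x.2.1.length * ((A.size x.1 + 1) * (x.2.1.length + 1)) +
        ((kernel ((r + 1) * x.2.2) x.2.1).length + 1) *
          (((kernel ((r + 1) * x.2.2) x.2.1).length + 1) ^ x.2.2 *
            (x.2.2 * (A.size x.1 ^ d + 1) + 1)) := by
  have h₁ := (runs_thresholds r).call
    (fun x : Σ i, List (SmallSet (A.size i) r) × ℕ => x.2.2)
    (D := fun x => A.encInstance x.1 x.2.1 x.2.2) Runs.refl.tl.tl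
  have h₂ := (runs_kernel r).call
    (fun x : Σ i, List (SmallSet (A.size i) r) × ℕ => ⟨(A.size x.1, (r + 1) * x.2.2), x.2.1⟩)
    (D := fun x => A.encInstance x.1 x.2.1 x.2.2) (Runs.refl.tl.hd.cons h₁)
  have h₃ := (runs_found hA).call
    (fun x : Σ i, List (SmallSet (A.size i) r) × ℕ =>
      ⟨x.1, kernel ((r + 1) * x.2.2) x.2.1, x.2.2⟩)
    (D := fun x => A.encInstance x.1 x.2.1 x.2.2) (Runs.refl.hd.cons (h₂.cons Runs.refl.tl.tl))
  exact h₃.of_le fun x => by simp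

end OverlapConstraint

end SetPacking

namespace SetPacking

open WhileLang

/-! ### Correctness and running time -/

namespace OverlapConstraint

variable {ι : Type*} {r d : ℕ} {A : OverlapConstraint ι r}

theorem ok_comm (A : OverlapConstraint ι r) (i : ι) (s t : SmallSet (A.size i) r) :
    A.ok i s t = A.ok i t s := Bool.and_comm _ _

theorem found_iff (A : OverlapConstraint ι r) (i : ι) (F : List (SmallSet (A.size i) r)) (k : ℕ) :
    A.found i F k = true ↔ ∃ q : List (SmallSet (A.size i) r), q.Sublist F ∧ q.length = k ∧
      q.Pairwise fun s t => A.ok i s t = true := by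
  have := exists_mem_foldl_branch_iff (A.ok_comm i) F [] k
  simp only [List.not_mem_nil, false_imp_iff, implies_true, and_true] at this
  rw [← this]
  simp [found, partialPackings]

/-- The place where well-conditioning enters. Heredity turns the compatibility of `w` and `s` into
that of `w` and `c`; condition (ii) for the conflict of `w` and `t` with the subsets `w` and `c`
then gives an element of `w ∩ t` outside `c`. Since `α` need not be symmetric, both orders are
treated. -/
theorem exists_mem_of_not_ok (hh : A.Hereditary) (hc : A.HasConflictingElements) (i : ι)
    (s w t : SmallSet (A.size i) r) (c : Finset (Fin (A.size i))) (hws : A.ok i w s = true)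
    (hcs : c ⊆ s.1) (hct : c ⊆ t.1) (hwt : A.ok i w t ≠ true) : ∃ u ∈ w.1, u ∈ t.1 ∧ u ∉ c := by
  let c' : SmallSet (A.size i) r := ⟨c, (Finset.card_le_card hcs).trans s.2⟩
  rw [ne_eq] at hwt
  simp only [ok, Bool.and_eq_true, Bool.not_eq_true', not_and_or, Bool.not_eq_false] at hws hwt
  rcases hwt with h | h
  · have := (hc i w t h).2 w c' subset_rfl hct (hh i w s hws.1 w c' subset_rfl hcs)
    obtain ⟨u, hu⟩ := Finset.nonempty_iff_ne_empty.2 this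
    simp only [Finset.mem_sdiff, Finset.mem_inter, c'] at hu
    exact ⟨u, hu.1.1, hu.1.2, fun h => hu.2 ⟨hu.1.1, h⟩⟩
  · have := (hc i t w h).2 c' w hct subset_rfl (hh i s w hws.2 c' w hcs subset_rfl)
    obtain ⟨u, hu⟩ := Finset.nonempty_iff_ne_empty.2 this
    simp only [Finset.mem_sdiff, Finset.mem_inter, c'] at hu
    exact ⟨u, hu.1.2, hu.1.1, fun h => hu.2 ⟨h, hu.1.2⟩⟩

theorem found_kernel_iff (hh : A.Hereditary) (hc : A.HasConflictingElements) (hr : 1 ≤ r) (i : ι)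
    {L : List (SmallSet (A.size i) r)} (hL : L.Nodup) (k : ℕ) :
    A.found i (kernel ((r + 1) * k) L) k = true ↔ A.HasPacking i L.toFinset k := by
  rw [found_iff]
  constructor
  · rintro ⟨q, hq, hk, hp⟩
    have hqn : q.Nodup := hq.nodup (kernel_nodup hL)
    refine ⟨q.toFinset, fun s hs => ?_, ?_, fun s hs t ht hst => ?_⟩
    · rw [List.mem_toFinset] at hs ⊢
      exact kernel_subset (hq.subset hs)
    · rw [List.toFinset_card_of_nodup hqn, hk]
    · rw [List.mem_toFinset] at hs ht
      have hsymm : Std.Symm (fun s t => A.ok i s t = true) :=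
        ⟨fun s t h => by rw [A.ok_comm]; exact h⟩
      have := hp.forall hs ht hst
      simp only [ok, Bool.and_eq_true, Bool.not_eq_true'] at this
      exact this.1
  · rintro ⟨K, hKL, hk, hK⟩
    obtain ⟨P, hPK, hP⟩ := Finset.exists_subset_card_eq hk
    obtain ⟨P', h₁, h₂, h₃⟩ := exists_packing_kernel (cf := fun s t => A.ok i s t ≠ true)
      (fun s t h => by rw [A.ok_comm]; exact h)
      (fun s w t c h₁ h₂ h₃ h₄ => exists_mem_of_not_ok hh hc i s w t c (not_not.1 h₁) h₂ h₃ h₄)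
      hr hL P (fun s hs => by simpa using hKL (hPK hs)) hP
      (fun s hs t ht hst => by
        simp [ok, hK s (hPK hs) t (hPK ht) hst, hK t (hPK ht) s (hPK hs) hst.symm])
    have hn := (kernel_nodup (q := (r + 1) * k) hL).filter (· ∈ P')
    refine ⟨(kernel ((r + 1) * k) L).filter (· ∈ P'), List.filter_sublist, ?_, ?_⟩
    · rw [← List.toFinset_card_of_nodup hn]
      refine Eq.trans (congrArg Finset.card (Finset.ext fun s => ?_)) h₂
      simp only [List.mem_toFinset, List.mem_filter, decide_eq_true_eq]
      exact ⟨fun h => h.2, fun h => ⟨h₁ s h, h⟩⟩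
    · refine hn.pairwise_of_forall_ne fun s hs t ht hst => ?_
      exact not_not.1 (h₃ s (by simpa using (List.mem_filter.1 hs).2) t
        (by simpa using (List.mem_filter.1 ht).2) hst)

end OverlapConstraint

/-- Listing the elements and padding with `none` embeds these sets into the functions from `Fin r`
to `Option (Fin n)`. -/
theorem card_smallSet_le (n r : ℕ) : Fintype.card (SmallSet n r) ≤ (n + 1) ^ r := by
  have h := Fintype.card_le_of_injective
    (fun (s : SmallSet n r) (j : Fin r) => s.1.toList[(j : ℕ)]?) fun s t hst => by
      have : s.1.toList = t.1.toList := by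
        refine List.ext_getElem? fun j => ?_
        by_cases hj : j < r
        · exact congrFun hst ⟨j, hj⟩
        · rw [List.getElem?_eq_none, List.getElem?_eq_none]
          · rw [Finset.length_toList]; exact t.2.trans (not_lt.1 hj)
          · rw [Finset.length_toList]; exact s.2.trans (not_lt.1 hj)
      refine Subtype.ext (Finset.ext fun u => ?_)
      rw [← Finset.mem_toList, this, Finset.mem_toList]
  simpa using h

/-- Exponential factors are absorbed by `k ^ k`: either `Q ≤ k`, or `k ≤ Q` and `Q ^ k` is at most
the constant `Q ^ Q`. -/
theorem pow_le_pow_self_mul (Q k : ℕ) (hk : 1 ≤ k) : Q ^ k ≤ Q ^ Q * k ^ k := by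
  rcases le_total Q k with h | h
  · rcases Nat.eq_zero_or_pos Q with rfl | hQ
    · simp [zero_pow (by omega : k ≠ 0)]
    · exact (Nat.pow_le_pow_left h k).trans (Nat.le_mul_of_pos_left _ (by positivity))
  · rcases Nat.eq_zero_or_pos Q with rfl | hQ
    · omega
    · exact (Nat.pow_le_pow_right hQ h).trans (Nat.le_mul_of_pos_right _ (by positivity))

/-- The running time of the kernelization and of the search. -/
theorem time_le (r d : ℕ) (hr : 1 ≤ r) : ∃ K : ℕ, ∀ n k l m : ℕ, 1 ≤ n → l ≤ (n + 1) ^ r →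
    m ≤ ((r + 1) * k) ^ r →
    (k + 1) ^ (r + 1) + l * ((n + 1) * (l + 1)) +
        (m + 1) * ((m + 1) ^ k * (k * (n ^ d + 1) + 1)) ≤
      K * (r ^ (r * k) * k ^ ((r + 1) * k) * n ^ ((d + 3) * r)) := by
  -- `E` is chosen so that `m + 1 ≤ E * k ^ r` for `k ≥ 1`; `Q` collects the base of `E ^ k` and
  -- that of the bound `k ^ (r + 1) ≤ (2 ^ (r + 1)) ^ k`. The three summands of the constant match
  -- those of the running time. The factor `r ^ (r * k)` is used only through being at least `1`.
  set E := 2 * (r + 1) ^ r with hE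
  set Q := E * 2 ^ (r + 1) with hQ
  refine ⟨2 ^ (r + 1) + 2 ^ r * (2 * (2 * 2 ^ r)) + (3 * E * Q ^ Q + 1), fun n k l m hn hl hm => ?_⟩
  have hrk : 1 ≤ r ^ (r * k) := Nat.one_le_pow _ _ hr
  have hW : k ^ ((r + 1) * k) ≤ r ^ (r * k) * k ^ ((r + 1) * k) := Nat.le_mul_of_pos_left _ hrk
  have hk1 : 1 ≤ k ^ ((r + 1) * k) := by
    rcases Nat.eq_zero_or_pos k with rfl | hk
    · simp
    · exact Nat.one_le_pow _ _ hk
  have hnd : n ^ d ≤ n ^ ((d + 3) * r) := Nat.pow_le_pow_right hn (by nlinarith)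
  -- Building the kernel takes about `n ^ (2 * r + 1)`, which is at most `n ^ (3 * r)` because `r ≥
  -- 1`; this is the `3` in the exponent.
  have hn3 : n ^ r * (n * n ^ r) ≤ n ^ ((d + 3) * r) := by
    rw [← pow_succ', ← pow_add]
    exact Nat.pow_le_pow_right hn (by nlinarith)
  have hnN : 1 ≤ n ^ ((d + 3) * r) := Nat.one_le_pow _ _ hn
  have h₁ : (k + 1) ^ (r + 1) ≤ 2 ^ (r + 1) * k ^ ((r + 1) * k) := by
    rcases Nat.eq_zero_or_pos k with rfl | hk
    · simpa using Nat.one_le_two_pow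
    · calc (k + 1) ^ (r + 1) ≤ (2 * k) ^ (r + 1) := Nat.pow_le_pow_left (by omega) _
        _ = 2 ^ (r + 1) * k ^ (r + 1) := mul_pow _ _ _
        _ ≤ _ := Nat.mul_le_mul_left _ (Nat.pow_le_pow_right hk (Nat.le_mul_of_pos_right _ hk))
  have h₂ : l * ((n + 1) * (l + 1)) ≤ 2 ^ r * (2 * (2 * 2 ^ r)) * (n ^ r * (n * n ^ r)) := by
    have hl' : l ≤ 2 ^ r * n ^ r := by
      rw [← mul_pow]
      exact hl.trans (Nat.pow_le_pow_left (by omega) _)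
    have hpos : 1 ≤ 2 ^ r * n ^ r := Nat.mul_pos (by positivity) (by positivity)
    calc l * ((n + 1) * (l + 1)) ≤ (2 ^ r * n ^ r) * ((2 * n) * (2 * (2 ^ r * n ^ r))) :=
          Nat.mul_le_mul hl' (Nat.mul_le_mul (by omega) (by omega))
      _ = _ := by ring
  have h₃ : (m + 1) * ((m + 1) ^ k * (k * (n ^ d + 1) + 1)) ≤
      (3 * E * Q ^ Q + 1) * (k ^ ((r + 1) * k) * n ^ d) := by
    have hnd1 : 1 ≤ n ^ d := Nat.one_le_pow _ _ hn
    rcases Nat.eq_zero_or_pos k with rfl | hk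
    · have : m = 0 := by simpa [zero_pow (by omega : r ≠ 0)] using hm
      subst this
      simp only [zero_add, zero_mul, mul_zero, pow_zero, one_mul]
      nlinarith [Nat.zero_le (3 * E * Q ^ Q)]
    · have hm' : m + 1 ≤ E * k ^ r := by
        rw [mul_pow] at hm
        have : 1 ≤ (r + 1) ^ r * k ^ r := Nat.mul_pos (by positivity) (by positivity)
        rw [hE]
        nlinarith
      have hkr : k ^ (r + 1) ≤ (2 ^ (r + 1)) ^ k := by
        rw [← pow_mul, mul_comm, pow_mul]
        exact Nat.pow_le_pow_left Nat.lt_two_pow_self.le _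
      calc (m + 1) * ((m + 1) ^ k * (k * (n ^ d + 1) + 1))
          ≤ (E * k ^ r) * ((E * k ^ r) ^ k * (3 * k * n ^ d)) :=
            Nat.mul_le_mul hm' (Nat.mul_le_mul (Nat.pow_le_pow_left hm' _) (by nlinarith))
        _ = 3 * E * (E ^ k * k ^ (r + 1) * k ^ (r * k) * n ^ d) := by
            rw [mul_pow, ← pow_mul, pow_succ]; ring
        _ ≤ 3 * E * (E ^ k * (2 ^ (r + 1)) ^ k * k ^ (r * k) * n ^ d) := by gcongr
        _ = 3 * E * (Q ^ k * k ^ (r * k) * n ^ d) := by rw [← mul_pow]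
        _ ≤ 3 * E * ((Q ^ Q * k ^ k) * k ^ (r * k) * n ^ d) := by
            gcongr
            exact pow_le_pow_self_mul Q k hk
        _ = 3 * E * Q ^ Q * (k ^ ((r + 1) * k) * n ^ d) := by
            rw [add_mul, one_mul, pow_add]; ring
        _ ≤ _ := Nat.mul_le_mul_right _ (Nat.le_succ _)
  generalize 2 ^ r * (2 * (2 * 2 ^ r)) = c₂ at *
  generalize 3 * E * Q ^ Q + 1 = c₃ at *
  generalize 2 ^ (r + 1) = c₁ at *
  rw [add_mul (c₁ + c₂), add_mul c₁]
  refine Nat.add_le_add (Nat.add_le_add (h₁.trans ?_) (h₂.trans ?_)) (h₃.trans ?_)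
  · exact Nat.mul_le_mul_left _ (hW.trans (Nat.le_mul_of_pos_right _ hnN))
  · exact Nat.mul_le_mul_left _ (hn3.trans (Nat.le_mul_of_pos_left _ (hk1.trans hW)))
  · exact Nat.mul_le_mul_left _ (Nat.mul_le_mul hW hnd)

namespace OverlapConstraint

variable {ι : Type*} {r d : ℕ} {A : OverlapConstraint ι r}

/-- Bridges two conventions: `Runs` allows time `O(T + 1)`, and `1 ≤ T` removes the summand.
Restricting to repetition-free lists is what later bounds their length by the number of small sets.
-/
theorem solvableInTime_of_runs {T : ℕ → ℕ → ℕ} (hT : ∀ i k, 1 ≤ T (A.size i) k)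
    {b : (Σ i, List (SmallSet (A.size i) r) × ℕ) → Bool}
    (hb : ∀ i L k, L.Nodup → (b ⟨i, L, k⟩ = true ↔ A.HasPacking i L.toFinset k))
    (h : Runs (fun x : {x : Σ i, List (SmallSet (A.size i) r) × ℕ // x.2.1.Nodup} =>
      A.encInstance x.1.1 x.1.2.1 x.1.2.2) (fun x => encBool (b x.1))
      fun x => T (A.size x.1.1) x.1.2.2) : A.SolvableInTime T := by
  obtain ⟨p, C, h⟩ := h
  refine ⟨p, C * 2, fun i L k hL => ⟨b ⟨i, L, k⟩, hb i L k hL, ?_⟩⟩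
  obtain ⟨σ, t, h₁, h₂, h₃⟩ := h ⟨⟨i, L, k⟩, hL⟩
  refine ⟨σ, t, h₁, h₂, h₃.trans ?_⟩
  rw [mul_assoc]
  refine Nat.mul_le_mul_left _ ?_
  have := hT i k
  simp only
  omega

/-- Collections of empty sets. -/
theorem solvableInTime_zero (A : OverlapConstraint ι 0) {T : ℕ → ℕ → ℕ}
    (hT : ∀ i k, 1 ≤ T (A.size i) k) : A.SolvableInTime T := by
  -- The empty set is the only possible member, so constant time suffices: the answer is yes for `k
  -- = 0`, no for `k ≥ 2`, and for `k = 1` it depends on whether the list is nonempty.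
  refine solvableInTime_of_runs hT (b := fun x => if decide (x.2.2 ≠ 0) then
    (if decide (x.2.2 - 1 ≠ 0) then false else decide (x.2.1 ≠ [])) else true) ?_ ?_
  · intro i L k _
    have : Subsingleton (SmallSet (A.size i) 0) := ⟨fun s t => Subtype.ext (by
      rw [Finset.card_eq_zero.1 (Nat.le_zero.1 s.2), Finset.card_eq_zero.1 (Nat.le_zero.1 t.2)])⟩
    match k with
    | 0 => simpa using ⟨∅, by simp, by simp, by simp⟩
    | 1 =>
      simp only [ne_eq, one_ne_zero, not_false_eq_true, decide_true, if_true, Nat.sub_self,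
        not_true_eq_false, decide_false, Bool.false_eq_true, if_false, decide_eq_true_eq]
      constructor
      · intro hL
        obtain ⟨s, hs⟩ := List.exists_mem_of_ne_nil L hL
        exact ⟨{s}, by simpa using hs, by simp, fun s _ t _ h => absurd (Subsingleton.elim s t) h⟩
      · rintro ⟨K, hK, hk, _⟩ rfl
        rw [List.toFinset_nil, Finset.subset_empty] at hK
        simp [hK] at hk
    | k + 2 =>
      simp only [ne_eq, Nat.add_eq_zero_iff, OfNat.ofNat_ne_zero, and_false, not_false_eq_true,
        decide_true, if_true, Nat.add_one_sub_one, one_ne_zero, Bool.false_eq_true, false_iff]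
      rintro ⟨K, -, hk, -⟩
      have := Finset.card_le_one_of_subsingleton K
      omega
  · have hk : Runs (fun x : {x : Σ i, List (SmallSet (A.size i) 0) × ℕ // x.2.1.Nodup} =>
        A.encInstance x.1.1 x.1.2.1 x.1.2.2) (fun x => encNat x.1.2.2) fun _ => 0 :=
      Runs.refl.tl.tl
    have hL : Runs (fun x : {x : Σ i, List (SmallSet (A.size i) 0) × ℕ // x.2.1.Nodup} =>
        A.encInstance x.1.1 x.1.2.1 x.1.2.2) (fun x => encBool (decide (x.1.2.1 ≠ [])))
        fun _ => 0 :=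
      Runs.bool_of_iff Runs.refl.tl.hd fun x => by
        cases h : x.1.2.1 <;> simp [encInstance, encList]
    refine ((hk.ite_of_iff (b := fun x => decide (x.1.2.2 ≠ 0)) (fun x => by
      simp [encNat_eq_nil]) (hk.tl.ite_of_iff (b := fun x => decide (x.1.2.2 - 1 ≠ 0)) (fun x => by
        rw [tl_encNat]; simp [encNat_eq_nil]) (Runs.const (encBool false)) hL)
        (Runs.const (encBool true))).congr fun x => ?_).of_le fun x => Nat.zero_le _
    rw [apply_ite encBool, apply_ite encBool]

theorem WellConditioned.solvableInTime (hA : A.WellConditioned d) :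
    A.SolvableInTime fun n k => r ^ (r * k) * k ^ ((r + 1) * k) * n ^ ((d + 3) * r) := by
  have hT : ∀ i k, 1 ≤ r ^ (r * k) * k ^ ((r + 1) * k) * A.size i ^ ((d + 3) * r) := by
    intro i k
    refine Nat.mul_pos (Nat.mul_pos ?_ ?_) (Nat.pow_pos (A.size_pos i))
    · rcases Nat.eq_zero_or_pos r with rfl | h
      · simp
      · exact Nat.pow_pos h
    · rcases Nat.eq_zero_or_pos k with rfl | h
      · simp
      · exact Nat.pow_pos h
  rcases Nat.eq_zero_or_pos r with rfl | hr
  · exact solvableInTime_zero A hT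
  obtain ⟨K, hK⟩ := time_le r d hr
  refine solvableInTime_of_runs hT
    (b := fun x => A.found x.1 (kernel ((r + 1) * x.2.2) x.2.1) x.2.2)
    (fun i L k hL => found_kernel_iff hA.hereditary hA.conflicting hr i hL k) ?_
  refine ((runs_found_kernel hA.computable).comap (fun x :
    {x : Σ i, List (SmallSet (A.size i) r) × ℕ // x.2.1.Nodup} => x.1)).mono K fun x => ?_
  exact (hK _ _ _ _ (A.size_pos _) (x.2.length_le_card.trans (card_smallSet_le _ _))
    (length_kernel_le _ _)).trans (Nat.mul_le_mul_left _ (Nat.le_succ _))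

end OverlapConstraint

theorem primrec_pow {f g : ℕ → ℕ} (hf : Primrec f) (hg : Primrec g) :
    Primrec fun k => f k ^ g k := by
  refine (Primrec.nat_rec' hg (Primrec.const 1) (h := fun k p => p.2 * f k)
    (Primrec.nat_mul.comp (Primrec.snd.comp Primrec.snd) (hf.comp Primrec.fst))).of_eq fun k => ?_
  induction g k with
  | zero => simp
  | succ j ih => simp only [pow_succ, ← ih]

end SetPacking

theorem mainTheorem1 (d : ℕ) :
    ∃ c : ℕ, ∀ (r : ℕ) (ι : Type*) (A : SetPacking.OverlapConstraint ι r), A.WellConditioned d →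
      (A.SolvableInTime fun n k => r ^ (r * k) * k ^ ((r + 1) * k) * n ^ (c * r)) ∧
      A.FixedParameterTractable := by
  -- With `r` fixed, the factor depending on `k` serves as `f`, which is primitive recursive; the
  -- exponent of `n` is the constant `(d + 3) * r`.
  refine ⟨d + 3, fun r ι A hA => ⟨hA.solvableInTime, _, ?_, _, hA.solvableInTime⟩⟩
  exact (Primrec.nat_mul.comp
    (SetPacking.primrec_pow (Primrec.const r) (Primrec.nat_mul.comp (Primrec.const r) Primrec.id))
    (SetPacking.primrec_pow Primrec.id
      (Primrec.nat_mul.comp (Primrec.const (r + 1)) Primrec.id))).to_comp
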